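/- Let $W$ be a finite or countably infinite set and let $\mathscr F$ be the free semigroup on $W$, including the empty word $e$. Let $\mu$ be a probability measure on $\mathscr F$ concentrated on the set $W$ of generators, and let $\mathbf P$ be the law on $\mathscr F^{\mathbb Z_+}$ of the path $x_0=e$, $x_n=h_1\cdots h_n$, where $h_1,h_2,\dots$ are independent with law $\mu$. Let $(\Omega,\lambda)$ be a probability space and let $\tau:\mathscr F^{\mathbb Z_+}\times\Omega\to\mathbb Z_+\cup\{\infty\}$ be a bounded randomized stopping time, that is: $\tau$ is measurable; for every $\omega\in\Omega$ the function $\tau(\cdot,\omega)$ is a stopping time for the filtration generated by the positions $x_0,\dots,x_n$; and there is an integer $M$ with $\tau\le M$ almost everywhere for $\mathbf P\otimes\lambda$. For $g\in\mathscr F$ put $\mu_\tau(g)=(\mathbf P\otimes\lambda)\{(\boldsymbol x,\omega): x_{\tau(\boldsymbol x,\omega)}=g\}$, and for $0<t\le 1$ put $\mu_{\tau,t}=t\mu+(1-t)\mu_\tau$. A function $f:\mathscr F\to\mathbb R$ is $\mu_{\tau,t}$-harmonic if, for every $x\in\mathscr F$, the series $\sum_{y\in\mathscr F}f(xy)\mu_{\tau,t}(y)$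 converges absolutely with sum $f(x)$; it is positive if $f\ge 0$. A positive $\mu_{\tau,t}$-harmonic function $f$ is minimal if $f(e)=1$ and, whenever $f=f_1+f_2$ with $f_1,f_2$ positive $\mu_{\tau,t}$-harmonic, both $f_1$ and $f_2$ are scalar multiples of $f$. For an infinite word $\boldsymbol g=g_1g_2\cdots$ all of whose letters satisfy $\mu(g_n)>0$ (no restriction if $\mu$ charges every generator), let $$u^{\boldsymbol g}(x)=K_\mu(x,\boldsymbol g)=\begin{cases}\dfrac1{\mu(w_1)\cdots\mu(w_n)} & \text{if } x=w_1\cdots w_n \text{ is an initial segment of } \boldsymbol g,\\[1ex] 0&\text{otherwise.}\end{cases}$$ Then a function $u:\mathscr F\to\mathbb R$ is a minimal positive $\mu_{\tau,t}$-harmonic function if and only if $u=u^{\boldsymbol g}$ for some infinite word $\boldsymbol g$ with $\mu(g_n)>0$ for all $n$. In particular, every such $u^{\boldsymbol g}$ is $\mu_{\tau,t}$-harmonic, and a positive $\mu_{\tau,t}$-harmonic function is minimal if and only if it is of the form $u^{\boldsymbol g}$. -/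

import Mathlib

open MeasureTheory ProbabilityTheory

noncomputable section

namespace FreeSemigroupWalk

/-! ### Random walks, stopping times and harmonic functions on a discrete monoid -/

section General

variable {G : Type*} [Monoid G]

/-- The position `x_n = h_1 ⋯ h_n` of the walk at time `n`, started at the identity, as a function
of the increments; the increment `h_{n+1}` is `h n`. -/
def position (h : ℕ → G) : ℕ → G
  | 0 => 1
  | n + 1 => position h n * h n

/-- The measure `P` on the space of sample paths: the image of the infinite product of copies of
`μ` on the space of increments under `(h_n) ↦ (x_n)`. -/
def pathMeasure [MeasurableSpace G] (μ : PMF G) : Measure (ℕ → G) :=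
  (Measure.infinitePi (fun _ : ℕ => μ.toMeasure)).map position

/-- A randomized stopping time over the parameter space `Ω`: a jointly measurable function with
values in `ℕ ∪ {∞}`, all of whose sections `τ(·, ω)` are stopping times with respect to the
filtration generated by the positions `x_0, …, x_n`. -/
structure IsRandomizedStoppingTime [MeasurableSpace G] {Ω : Type*} [MeasurableSpace Ω]
    (τ : (ℕ → G) × Ω → WithTop ℕ) : Prop where
  measurable : Measurable τ
  isStoppingTime : ∀ ω : Ω,
    IsStoppingTime (Filtration.piLE (X := fun _ : ℕ => G)) (fun x => τ (x, ω))

/-- `μ_τ(g) = (P ⊗ λ) {(x, ω) : τ(x, ω) < ∞ and x_{τ(x, ω)} = g}`. -/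
def stoppedLaw [MeasurableSpace G] {Ω : Type*} [MeasurableSpace Ω] (μ : PMF G) (lam : Measure Ω)
    (τ : (ℕ → G) × Ω → WithTop ℕ) (g : G) : ℝ :=
  ((pathMeasure μ).prod lam).real {p | ∃ n : ℕ, τ p = (n : WithTop ℕ) ∧ p.1 n = g}

/-- The convex combination `μ_{τ,t} = t μ + (1 - t) μ_τ`. -/
def mixedLaw [MeasurableSpace G] {Ω : Type*} [MeasurableSpace Ω] (μ : PMF G) (lam : Measure Ω)
    (τ : (ℕ → G) × Ω → WithTop ℕ) (t : ℝ) (g : G) : ℝ :=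
  t * (μ g).toReal + (1 - t) * stoppedLaw μ lam τ g

/-- `f` is `ν`-harmonic: for every `g` the series `∑_h f(gh) ν(h)` converges absolutely, with sum
`f(g)`. (For real series `HasSum` is unconditional, that is absolute, convergence.) -/
def IsHarmonic (ν : G → ℝ) (f : G → ℝ) : Prop :=
  ∀ g : G, HasSum (fun h : G => f (g * h) * ν h) (f g)

/-- `H⁺(G, ν)`: the nonnegative `ν`-harmonic functions. -/
def positiveHarmonic (ν : G → ℝ) : Set (G → ℝ) :=
  {f | (∀ g, 0 ≤ f g) ∧ IsHarmonic ν f}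

/-- Minimal harmonic functions: positive harmonic functions `f` with `f(e) = 1` such that both
summands of any decomposition `f = f₁ + f₂` into positive harmonic functions are proportional
to `f`. -/
def IsMinimalHarmonic (ν : G → ℝ) (f : G → ℝ) : Prop :=
  f ∈ positiveHarmonic ν ∧ f 1 = 1 ∧
    ∀ f₁ ∈ positiveHarmonic ν, ∀ f₂ ∈ positiveHarmonic ν, f = f₁ + f₂ →
      (∃ c : ℝ, f₁ = c • f) ∧ (∃ c : ℝ, f₂ = c • f)

end General

/-! ### The free semigroup with identity on a set of letters -/

section Free

variable {W : Type*}

/-- Words carry the discrete σ-algebra. -/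
instance : MeasurableSpace (FreeMonoid W) := ⊤

instance : DiscreteMeasurableSpace (FreeMonoid W) := ⟨fun _ => trivial⟩

/-- `μ^{|x|}(x) = μ(w_1) ⋯ μ(w_n)` for `x = w_1 ⋯ w_n`. -/
def wordWeight (μ : PMF (FreeMonoid W)) (x : FreeMonoid W) : ℝ :=
  (x.toList.map fun w => (μ (FreeMonoid.of w)).toReal).prod

/-- `x ≤ g`: the finite word `x` is an initial segment of the infinite word `g`. -/
def IsInitialSegment (x : FreeMonoid W) (g : ℕ → W) : Prop :=
  ∃ n : ℕ, x = FreeMonoid.ofList (List.ofFn fun i : Fin n => g i)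

open Classical in
/-- The Martin kernel `K_μ(x, g)` at an infinite word `g`. As a function of `x` it is `u^g`. -/
def martinKernel (μ : PMF (FreeMonoid W)) (x : FreeMonoid W) (g : ℕ → W) : ℝ :=
  if IsInitialSegment x g then 1 / wordWeight μ x else 0

end Free

end FreeSemigroupWalk

end

open scoped ENNReal NNReal

namespace FreeSemigroupWalk

/-! ### Contraction of solutions of a backward renewal recursion -/

section Ray

/-! Attach to f the density m(x) = f(x) μ(w_1)⋯μ(w_n). In a free semigroup a word determines the
path leading to it, so μ_{τ,t}(y) is the weight of y times a factor q(y); on words of positive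
weight, q(y) is t·1_{|y|=1} plus (1-t) times the conditional probability of stopping at y. A bounded
τ stops exactly once along each path, so q can be chosen with total mass 1 along every infinite word
and no mass beyond length M. Off the null words, harmonicity reads m(x) = ∑ q(y) m(xy).

The core is `IsStoppingWeight.eq_tsum_iff_isFlow`: the finite solutions are exactly the flows m(x) =
∑_w m(xw), whatever τ is. A flow is a solution by optional stopping. Conversely, discard the empty
jump, renormalize, and let the jumps run until length n is reached: m(x) is an average of m(xy) over
first entrance words y. The same holds from each child xw. Along a fixed ray, entrance weights seen
from neighbouring positions differ by an exponentially small amount, because one-letter jumps of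
weight at least t couple them (`IsRenewalRecursion.osc`). The total mass of the levels involved
stays bounded (`IsJumpWeight.tsum_window_le`), so the two averages agree in the limit.

An extremal unit flow takes only the values 0 and 1 and hence follows one infinite word; a flow
carried by one word is a multiple of its unit flow. Minimal functions vanish on null words, so
nothing is lost in passing to densities. -/

lemma sub_le_convexCombination_sub {M : ℕ} {c x : ℕ → ℝ} {t B : ℝ} (hM : 0 < M)
    (hc : ∀ j, 0 ≤ c j) (hsum : ∑ j ∈ Finset.range M, c j = 1) (ht : t ≤ c 0)
    (hx : ∀ j < M, B ≤ x j) :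
    t * (x 0 - B) ≤ ∑ j ∈ Finset.range M, c j * x j - B := by
  have h1 : ∑ j ∈ Finset.range M, c j * x j - B = ∑ j ∈ Finset.range M, c j * (x j - B) := by
    simp only [mul_sub, Finset.sum_sub_distrib, ← Finset.sum_mul, hsum, one_mul]
  rw [h1]
  calc t * (x 0 - B) ≤ c 0 * (x 0 - B) :=
        mul_le_mul_of_nonneg_right ht (sub_nonneg.2 (hx 0 hM))
    _ ≤ _ := Finset.single_le_sum (f := fun j => c j * (x j - B))
        (fun j hj => mul_nonneg (hc j) (sub_nonneg.2 (hx j (Finset.mem_range.1 hj))))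
        (Finset.mem_range.2 hM)

/-- `v` solves a backward recursion below level `N`: each value is a convex combination of the
next `M` values, the first of which has weight at least `t`. -/
structure IsRenewalRecursion (M N : ℕ) (t : ℝ) (c : ℕ → ℕ → ℝ) (v : ℕ → ℝ) : Prop where
  width_pos : 0 < M
  weight_nonneg : ∀ k j, 0 ≤ c k j
  weight_sum : ∀ k < N, ∑ j ∈ Finset.range M, c k j = 1
  le_weight : ∀ k < N, t ≤ c k 0
  eq_sum : ∀ k < N, v k = ∑ j ∈ Finset.range M, c k j * v (k + 1 + j)

variable {M N : ℕ} {t : ℝ} {c : ℕ → ℕ → ℝ} {v : ℕ → ℝ}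

lemma IsRenewalRecursion.neg (h : IsRenewalRecursion M N t c v) :
    IsRenewalRecursion M N t c (fun k => -v k) :=
  ⟨h.width_pos, h.weight_nonneg, h.weight_sum, h.le_weight, fun k hk => by
    simp [h.eq_sum k hk]⟩

lemma IsRenewalRecursion.step (h : IsRenewalRecursion M N t c v) {k : ℕ} (hk : k < N) {B : ℝ}
    (hB : ∀ j < M, B ≤ v (k + 1 + j)) : t * (v (k + 1) - B) ≤ v k - B := by
  rw [h.eq_sum k hk]
  exact sub_le_convexCombination_sub (x := fun j => v (k + 1 + j)) h.width_pos
    (h.weight_nonneg k) (h.weight_sum k hk) (h.le_weight k hk) hB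

/-- Each one-letter jump costs a factor t. The second conclusion is carried along because `step`
needs the bound B on the whole window ahead. -/
lemma IsRenewalRecursion.window (h : IsRenewalRecursion M N t c v) (ht0 : 0 < t)
    {K : ℕ} (hK : K ≤ N) {B : ℝ} (hB : ∀ i, K ≤ i → i ≤ K + M → B ≤ v i) (n : ℕ) :
    ∀ k, k + n = K → t ^ n * (v K - B) ≤ v k - B ∧ ∀ i, k ≤ i → i ≤ K + M → B ≤ v i := by
  have h0 : 0 ≤ v K - B := sub_nonneg.2 (hB K le_rfl (Nat.le_add_right _ _))
  induction n with
  | zero => rintro k rfl; exact ⟨by simp, hB⟩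
  | succ n ih =>
    intro k hk
    obtain ⟨h1, h2⟩ := ih (k + 1) (by omega)
    have h3 : t * (v (k + 1) - B) ≤ v k - B :=
      h.step (by omega) fun j hj => h2 _ (by omega) (by have := h.width_pos; omega)
    have h4 : t ^ (n + 1) * (v K - B) ≤ v k - B := by
      rw [pow_succ', mul_assoc]
      exact (mul_le_mul_of_nonneg_left h1 ht0.le).trans h3
    refine ⟨h4, fun i hi hiK => ?_⟩
    rcases hi.eq_or_lt with rfl | hi
    · have : 0 ≤ t ^ (n + 1) * (v K - B) := mul_nonneg (pow_nonneg ht0.le _) h0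
      linarith
    · exact h2 i hi hiK

lemma IsRenewalRecursion.window_pow (h : IsRenewalRecursion M N t c v) (ht0 : 0 < t) (ht1 : t ≤ 1)
    {K : ℕ} (hK : K ≤ N) {B : ℝ} (hB : ∀ i, K ≤ i → i ≤ K + M → B ≤ v i) {k : ℕ} (hk : k ≤ K)
    (hkM : K ≤ k + (M + 1)) : t ^ (M + 1) * (v K - B) ≤ v k - B := by
  obtain ⟨n, rfl⟩ := Nat.exists_eq_add_of_le hk
  refine le_trans ?_ (h.window ht0 hK hB n k rfl).1
  refine mul_le_mul_of_nonneg_right (pow_le_pow_of_le_one ht0.le ht1 (by omega)) ?_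
  exact sub_nonneg.2 (hB _ le_rfl (Nat.le_add_right _ _))

lemma IsRenewalRecursion.osc (h : IsRenewalRecursion M N t c v) (ht0 : 0 < t) (ht1 : t ≤ 1)
    (hv0 : ∀ k, N ≤ k → 0 ≤ v k) (hv1 : ∀ k, N ≤ k → v k ≤ 1) (n : ℕ) :
    ∀ k, k + n * (M + 1) = N → ∃ A B, A - B ≤ (1 - t ^ (M + 1)) ^ n ∧
      ∀ i, k ≤ i → i ≤ k + M → B ≤ v i ∧ v i ≤ A := by
  induction n with
  | zero =>
    intro k hk
    exact ⟨1, 0, by simp, fun i hi _ => ⟨hv0 i (by omega), hv1 i (by omega)⟩⟩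
  | succ n ih =>
    intro k hk
    rw [Nat.succ_mul] at hk
    obtain ⟨A, B, hAB, hw⟩ := ih (k + (M + 1)) (by omega)
    have hp : (0 : ℝ) ≤ 1 - t ^ (M + 1) := sub_nonneg.2 (pow_le_one₀ ht0.le ht1)
    set a := v (k + (M + 1)) with ha
    -- The single value a pulls both ends of the range toward itself; the two gains add up to
    -- t^(M+1) (A - B), wherever a lies.
    refine ⟨A - t ^ (M + 1) * (A - a), B + t ^ (M + 1) * (a - B), ?_, fun i hi hi' => ⟨?_, ?_⟩⟩
    · calc _ = (1 - t ^ (M + 1)) * (A - B) := by ring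
        _ ≤ (1 - t ^ (M + 1)) * (1 - t ^ (M + 1)) ^ n := mul_le_mul_of_nonneg_left hAB hp
        _ = _ := by ring
    · have := h.window_pow ht0 ht1 (K := k + (M + 1)) (by omega) (B := B)
        (fun i hi hi' => (hw i hi hi').1) (k := i) (by omega) (by omega)
      linarith
    · have := h.neg.window_pow ht0 ht1 (K := k + (M + 1)) (by omega) (B := -A)
        (fun i hi hi' => neg_le_neg (hw i hi hi').2) (k := i) (by omega) (by omega)
      simp only [← ha] at this
      linarith

/-- Within distance M of N, one-letter jumps reach N with weight at least t^M. From farther away no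
jump passes N, so the bound is inherited by averaging. -/
lemma IsRenewalRecursion.le_of_boundary (h : IsRenewalRecursion M N t c v) (ht0 : 0 < t)
    (ht1 : t ≤ 1) (hv0 : ∀ k, N ≤ k → 0 ≤ v k) (hN : v N = 1) {k : ℕ} (hk : k ≤ N) :
    t ^ M ≤ v k := by
  obtain ⟨n, rfl⟩ := Nat.exists_eq_add_of_le hk
  induction n using Nat.strong_induction_on generalizing k with
  | _ n ih =>
    rcases le_or_gt n M with hn | hn
    · have := (h.window ht0 le_rfl (B := 0) (fun i hi _ => hv0 i hi) n k rfl).1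
      rw [hN, sub_zero, sub_zero, mul_one] at this
      exact (pow_le_pow_of_le_one ht0.le ht1 hn).trans this
    · have hw : ∀ j < M, t ^ M ≤ v (k + 1 + j) := by
        intro j hj
        have e : k + n = k + 1 + j + (n - (1 + j)) := by omega
        have := ih (n - (1 + j)) (by omega) (k := k + 1 + j)
        rw [← e] at this
        exact this h hv0 hN (by omega)
      have := h.step (show k < k + n by omega) hw
      have h0 : t ^ M ≤ v (k + 1) := hw 0 h.width_pos
      nlinarith [mul_nonneg ht0.le (sub_nonneg.2 h0)]

end Ray

/-! ### The first entrance law of a walk on words -/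

section FirstEntrance

variable {W : Type*}

/-- `firstEntrance q n y` is the weight with which the walk on words, started at the empty word,
whose jump along a given infinite word is `y` with weight `q y`, first enters
`{z : n ≤ |z|}` at `y`. -/
def firstEntrance (q : List W → ℝ≥0) : ℕ → List W → ℝ≥0
  | 0, y => if y.length = 0 then 1 else 0
  -- The first jump has j + 1 letters. The truncated `n - j` is 0 once the level is reached, and the
  -- base clause then forces the rest of y to be empty.
  | n + 1, y => ∑ j ∈ Finset.range y.length,
      q (y.take (j + 1)) * firstEntrance q (n - j) (y.drop (j + 1))
  termination_by n => n
  decreasing_by omega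

lemma firstEntrance_zero (q : List W → ℝ≥0) (y : List W) :
    firstEntrance q 0 y = if y.length = 0 then 1 else 0 := by
  rw [firstEntrance]

lemma firstEntrance_succ (q : List W → ℝ≥0) (n : ℕ) (y : List W) :
    firstEntrance q (n + 1) y = ∑ j ∈ Finset.range y.length,
      q (y.take (j + 1)) * firstEntrance q (n - j) (y.drop (j + 1)) := by
  rw [firstEntrance]

/-- The jumps of a walk on words are at most `M` letters long, at least one letter long, and have
total weight one along each ray; the one-letter jumps have weight at least `t`. -/
structure IsJumpWeight (M : ℕ) (t : ℝ) (q : List W → ℝ≥0) : Prop where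
  sum_eq_one : ∀ z : List W, M ≤ z.length → ∑ j ∈ Finset.range M, q (z.take (j + 1)) = 1
  eq_zero : ∀ y : List W, M < y.length → q y = 0
  le_singleton : ∀ w : W, t ≤ q [w]

variable {M : ℕ} {t : ℝ} {q : List W → ℝ≥0}

lemma IsJumpWeight.pos (hq : IsJumpWeight M t q) : 0 < M := by
  rcases Nat.eq_zero_or_pos M with rfl | h
  · simpa using hq.sum_eq_one []
  · exact h

lemma IsJumpWeight.firstEntrance_support (hq : IsJumpWeight M t q) (n : ℕ) (y : List W)
    (h : firstEntrance q n y ≠ 0) : n ≤ y.length ∧ y.length ≤ n + M := by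
  induction n using Nat.strong_induction_on generalizing y with
  | _ n ih =>
    cases n with
    | zero =>
      rw [firstEntrance_zero] at h
      have : y.length = 0 := by by_contra h'; simp [h'] at h
      omega
    | succ n =>
      rw [firstEntrance_succ] at h
      obtain ⟨j, hj, hne⟩ := Finset.exists_ne_zero_of_sum_ne_zero h
      rw [Finset.mem_range] at hj
      have h1 := left_ne_zero_of_mul hne
      have h2 := right_ne_zero_of_mul hne
      have hjM : j + 1 ≤ M := by
        by_contra hlt
        exact h1 (hq.eq_zero _ (by rw [List.length_take]; omega))
      rcases le_or_gt n j with hnj | hnj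
      · rw [Nat.sub_eq_zero_of_le hnj, firstEntrance_zero] at h2
        have : (y.drop (j + 1)).length = 0 := by
          by_contra h'
          rw [if_neg h'] at h2
          exact h2 rfl
        rw [List.length_drop] at this
        omega
      · obtain ⟨h3, h4⟩ := ih (n - j) (by omega) _ h2
        rw [List.length_drop] at h3 h4
        omega

/-- With z fixed and the starting position k varying, conditioning on the first jump gives the
recursion. Padding z by M letters keeps the jump weights summing to 1 near its end; positions past z
get value 0. -/
lemma IsJumpWeight.isRenewalRecursion (hq : IsJumpWeight M t q) (w₀ : W) (z : List W) {N : ℕ}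
    (hN : N ≤ z.length) :
    IsRenewalRecursion M N t
      (fun k j => q ((((z ++ List.replicate M w₀).drop k).take (j + 1))))
      (fun k => if k ≤ z.length then firstEntrance q (N - k) (z.drop k) else 0) := by
  refine ⟨hq.pos, fun _ _ => NNReal.coe_nonneg _, fun k hk => ?_, fun k hk => ?_, fun k hk => ?_⟩
  · have := hq.sum_eq_one ((z ++ List.replicate M w₀).drop k)
      (by rw [List.length_drop, List.length_append, List.length_replicate]; omega)
    exact_mod_cast this
  · have : (((z ++ List.replicate M w₀).drop k).take (0 + 1)) =
        [(z ++ List.replicate M w₀)[k]'(by rw [List.length_append]; omega)] := by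
      rw [List.drop_eq_getElem_cons (by rw [List.length_append]; omega), List.take_succ_cons,
        List.take_zero]
    rw [this]
    exact hq.le_singleton _
  · obtain ⟨n, hn⟩ : ∃ n, N - k = n + 1 := ⟨N - k - 1, by omega⟩
    have hlen : (z.drop k).length = z.length - k := List.length_drop
    rw [if_pos (by omega), hn, firstEntrance_succ, NNReal.coe_sum, hlen]
    trans ∑ j ∈ Finset.range (z.length - k),
      (q ((((z ++ List.replicate M w₀).drop k).take (j + 1))) : ℝ) *
        (if k + 1 + j ≤ z.length then
          (firstEntrance q (N - (k + 1 + j)) (z.drop (k + 1 + j)) : ℝ) else 0)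
    · refine Finset.sum_congr rfl fun j hj => ?_
      rw [Finset.mem_range] at hj
      rw [if_pos (by omega), List.drop_append_of_le_length (by omega),
        List.take_append_of_le_length (by rw [hlen]; omega), NNReal.coe_mul, List.drop_drop,
        show N - (k + 1 + j) = n - j by omega, show k + (j + 1) = k + 1 + j by omega]
    -- Both sums extend to a common range: jumps longer than M have weight 0, and landings past z
    -- have value 0.
    · rw [Finset.sum_subset (Finset.range_mono (Nat.le_add_right (z.length - k) M)), eq_comm,
        Finset.sum_subset (Finset.range_mono (Nat.le_add_left M (z.length - k)))]
      · intro j hj hj'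
        rw [Finset.mem_range] at hj hj'
        rw [hq.eq_zero, NNReal.coe_zero, zero_mul]
        simp only [List.length_take, List.length_drop, List.length_append, List.length_replicate]
        omega
      · intro j hj hj'
        rw [Finset.mem_range] at hj hj'
        rw [if_neg (by omega), mul_zero]

lemma IsJumpWeight.le_one [Nonempty W] (hq : IsJumpWeight M t q) : t ≤ 1 := by
  obtain ⟨w₀⟩ := ‹Nonempty W›
  have h := hq.isRenewalRecursion w₀ [w₀] (N := 1) (by simp)
  refine (h.le_weight 0 one_pos).trans ?_
  rw [← h.weight_sum 0 one_pos]
  exact Finset.single_le_sum (fun j _ => h.weight_nonneg 0 j) (Finset.mem_range.2 h.width_pos)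

lemma IsJumpWeight.pow_le_firstEntrance [Nonempty W] (hq : IsJumpWeight M t q) (ht : 0 < t)
    (z : List W) : t ^ M ≤ firstEntrance q z.length z := by
  obtain ⟨w₀⟩ := ‹Nonempty W›
  have := (hq.isRenewalRecursion w₀ z le_rfl).le_of_boundary ht hq.le_one
    (fun k _ => by split_ifs <;> simp) (by simp [firstEntrance_zero]) (Nat.zero_le _)
  simpa using this

/-- Entrance laws into a distant level seen from two consecutive positions are close. -/
lemma IsJumpWeight.abs_firstEntrance_sub_le [Nonempty W] (hq : IsJumpWeight M t q) (ht : 0 < t)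
    (n : ℕ) (z : List W) (hz : n * (M + 1) ≤ z.length) (hM : 0 < n) :
    |(firstEntrance q (n * (M + 1)) z : ℝ) - firstEntrance q (n * (M + 1) - 1) z.tail| ≤
      (1 - t ^ (M + 1)) ^ n := by
  obtain ⟨w₀⟩ := ‹Nonempty W›
  have hN : 1 ≤ n * (M + 1) := Nat.mul_pos hM (Nat.succ_pos _)
  have hb : ∀ k, n * (M + 1) ≤ k → k ≤ z.length →
      (firstEntrance q (n * (M + 1) - k) (z.drop k) : ℝ) ≤ 1 := by
    intro k hk _
    rw [Nat.sub_eq_zero_of_le hk, firstEntrance_zero]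
    split_ifs <;> simp
  obtain ⟨A, B, hAB, hw⟩ := (hq.isRenewalRecursion w₀ z hz).osc ht hq.le_one
    (fun k _ => by split_ifs <;> simp)
    (fun k hk => by
      split_ifs with h
      · exact hb k hk h
      · exact zero_le_one) n 0 (by simp)
  -- Positions 0 and 1 both lie in the last window, since M ≥ 1.
  have h0 := hw 0 le_rfl (Nat.zero_le _)
  have h1 := hw 1 (Nat.zero_le _) (by have := hq.pos; omega)
  simp only [Nat.zero_le, if_true, Nat.sub_zero, List.drop_zero, hN.trans hz, List.drop_one]
    at h0 h1
  rw [abs_le]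
  constructor <;> linarith

end FirstEntrance

/-! ### Sums over words -/

section Sums

variable {W : Type*}

lemma tsum_word_eq_nil_add (F : List W → ℝ≥0∞) :
    ∑' y, F y = F [] + ∑' (w) (y), F (w :: y) := by
  have hinj : Function.Injective fun p : W × List W => p.1 :: p.2 := by
    rintro ⟨w, y⟩ ⟨w', y'⟩ h
    simpa using h
  have hsupp : Function.support (fun x : List W => if x = [] then 0 else F x) ⊆
      Set.range fun p : W × List W => p.1 :: p.2 := by
    intro x h
    have hx : x ≠ [] := by
      rintro rfl
      simp at h
    exact ⟨(x.head hx, x.tail), List.cons_head_tail hx⟩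
  have h1 := hinj.tsum_eq hsupp
  rw [ENNReal.tsum_prod'] at h1
  simp only [reduceCtorEq, if_false] at h1
  rw [h1]
  have h2 := ENNReal.tsum_eq_add_tsum_ite (f := F) ([] : List W)
  rw [h2]
  congr 1
  refine tsum_congr fun x => ?_
  cases x <;> simp

lemma tsum_append (F : List W → List W → ℝ≥0∞) :
    ∑' (y) (z), F y z = ∑' x : List W, ∑ j ∈ Finset.range (x.length + 1),
      F (x.take j) (x.drop j) := by
  let e : List W × List W ≃ (Σ x : List W, Fin (x.length + 1)) :=
    { toFun := fun p => ⟨p.1 ++ p.2, ⟨p.1.length, by rw [List.length_append]; omega⟩⟩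
      invFun := fun s => (s.1.take s.2, s.1.drop s.2)
      left_inv := by rintro ⟨y, z⟩; simp
      right_inv := by
        rintro ⟨x, j, hj⟩
        have h1 : x.take j ++ x.drop j = x := List.take_append_drop _ _
        have h2 : (x.take j).length = j := by rw [List.length_take]; omega
        refine Sigma.ext h1 ?_
        refine (Fin.heq_ext_iff (by simp only [h1])).2 h2 }
  rw [← ENNReal.tsum_prod, ← e.symm.tsum_eq, ENNReal.tsum_sigma']
  refine tsum_congr fun x => ?_
  rw [tsum_fintype, Finset.sum_range]
  rfl

end Sums

/-! ### Harmonic densities on words -/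

section Core

variable {W : Type*}

/-- A flow on the tree of words: the mass at a word is the sum of the masses at its successors. -/
def IsFlow (m : List W → ℝ≥0∞) : Prop :=
  ∀ x, m x = ∑' w, m (x ++ [w])

/-- Optional stopping, by induction on the bound M. The total s is arbitrary because, past the first
letter, the remaining mass is s - q []. -/
lemma IsFlow.mul_eq_tsum [Nonempty W] (M : ℕ) {m : List W → ℝ≥0∞} (hm : IsFlow m)
    (q : List W → ℝ≥0∞) (s : ℝ≥0∞) (hs : s ≠ ∞)
    (hsum : ∀ z : List W, M ≤ z.length → ∑ j ∈ Finset.range (M + 1), q (z.take j) = s)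
    (hq : ∀ y : List W, M < y.length → q y = 0) (x : List W) :
    s * m x = ∑' y, q y * m (x ++ y) := by
  induction M generalizing q s x with
  | zero =>
    have h0 : q [] = s := by simpa using hsum [] le_rfl
    rw [tsum_eq_single [], h0, List.append_nil]
    intro y hy
    rw [hq y (List.length_pos_of_ne_nil hy), zero_mul]
  | succ M ih =>
    have hle : q [] ≤ s := by
      obtain ⟨w⟩ := ‹Nonempty W›
      rw [← hsum (List.replicate (M + 1) w) (by simp), Finset.sum_range_succ']
      exact le_add_self
    have hne : q [] ≠ ∞ := ne_top_of_le_ne_top hs hle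
    have key : ∀ w, (s - q []) * m (x ++ [w]) = ∑' y, q (w :: y) * m (x ++ w :: y) := by
      intro w
      rw [ih (fun y => q (w :: y)) (s - q []) (ne_top_of_le_ne_top hs tsub_le_self)]
      · simp
      · intro z hz
        have := hsum (w :: z) (by simpa using hz)
        rw [Finset.sum_range_succ'] at this
        simp only [List.take_succ_cons, List.take_zero] at this
        rw [← this, ENNReal.add_sub_cancel_right hne]
      · intro y hy
        exact hq _ (by simpa using hy)
    rw [tsum_word_eq_nil_add, List.append_nil]
    simp_rw [← key]
    rw [ENNReal.tsum_mul_left, ← hm x, ← add_mul, add_tsub_cancel_of_le hle]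

variable {M : ℕ} {t : ℝ} {q : List W → ℝ≥0} {m : List W → ℝ≥0∞}

/-- The mean value property at the first entrance time. -/
lemma eq_tsum_firstEntrance (hm : ∀ x, m x = ∑' (w) (y), q (w :: y) * m (x ++ w :: y)) (n : ℕ)
    (x : List W) : m x = ∑' y, firstEntrance q n y * m (x ++ y) := by
  induction n using Nat.strong_induction_on generalizing x with
  | _ n ih =>
    cases n with
    | zero =>
      rw [tsum_eq_single []]
      · simp [firstEntrance_zero]
      · intro y hy
        simp [firstEntrance_zero, hy]
    | succ n =>
      -- Make one nonempty jump y, apply induction at the reduced level, then regroup by the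
      -- concatenated word.
      have h1 : m x = ∑' (y) (z), (if y = [] then 0 else (q y : ℝ≥0∞)) *
          (firstEntrance q (n + 1 - y.length) z * m (x ++ y ++ z)) := by
        rw [tsum_word_eq_nil_add]
        simp only [if_true, zero_mul, tsum_zero, zero_add, reduceCtorEq, if_false]
        rw [hm x]
        refine tsum_congr fun w => tsum_congr fun y => ?_
        rw [ENNReal.tsum_mul_left, ← ih _ (by simp)]
      rw [h1, tsum_append fun y z => (if y = [] then 0 else (q y : ℝ≥0∞)) *
          (firstEntrance q (n + 1 - y.length) z * m (x ++ y ++ z))]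
      refine tsum_congr fun y => ?_
      rw [Finset.sum_range_succ', firstEntrance_succ, ENNReal.ofNNReal_finsetSum, Finset.sum_mul]
      simp only [List.take_zero, if_true, zero_mul, add_zero]
      refine Finset.sum_congr rfl fun j hj => ?_
      rw [Finset.mem_range] at hj
      have h2 : (y.take (j + 1)).length = j + 1 := by rw [List.length_take]; omega
      have h3 : y.take (j + 1) ≠ [] := by rintro h; rw [h] at h2; simp at h2
      rw [if_neg h3, h2, Nat.add_sub_add_right, List.append_assoc, List.take_append_drop,
        ENNReal.coe_mul, mul_assoc]

/-- The mass of a level is bounded by the mass at the root. -/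
lemma IsJumpWeight.tsum_level_le [Nonempty W] (hq : IsJumpWeight M t q) (ht : 0 < t)
    (hm : ∀ x, m x = ∑' (w) (y), q (w :: y) * m (x ++ w :: y)) (n : ℕ) (x : List W) :
    ∑' y : List W, (if y.length = n then m (x ++ y) else 0) ≤
      (ENNReal.ofReal (t ^ M))⁻¹ * m x := by
  have hp : ENNReal.ofReal (t ^ M) ≠ 0 := by simpa using pow_pos ht M
  rw [← ENNReal.mul_le_iff_le_inv hp ENNReal.ofReal_ne_top, ← ENNReal.tsum_mul_left,
    eq_tsum_firstEntrance hm n x]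
  -- Words of length exactly n carry entrance weight at least t^M; all other entrance words are
  -- dropped.
  refine ENNReal.tsum_le_tsum fun y => ?_
  split_ifs with h
  · subst h
    gcongr
    rw [ENNReal.ofReal_le_iff_le_toReal ENNReal.coe_ne_top]
    exact hq.pow_le_firstEntrance ht y
  · simp

lemma IsJumpWeight.tsum_window_le [Nonempty W] (hq : IsJumpWeight M t q) (ht : 0 < t)
    (hm : ∀ x, m x = ∑' (w) (y), q (w :: y) * m (x ++ w :: y)) (n : ℕ) (x : List W) :
    ∑' y : List W, (if n ≤ y.length ∧ y.length ≤ n + M then m (x ++ y) else 0) ≤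
      (M + 1 : ℕ) * ((ENNReal.ofReal (t ^ M))⁻¹ * m x) := by
  calc _ ≤ ∑' y : List W, ∑ i ∈ Finset.range (M + 1),
        (if y.length = n + i then m (x ++ y) else 0) := by
        refine ENNReal.tsum_le_tsum fun y => ?_
        split_ifs with h
        · refine le_trans ?_ (Finset.single_le_sum (fun i _ => zero_le)
            (Finset.mem_range.2 (show y.length - n < M + 1 by omega)))
          rw [if_pos (by omega)]
        · exact zero_le
    _ = ∑ i ∈ Finset.range (M + 1), ∑' y : List W,
        (if y.length = n + i then m (x ++ y) else 0) :=
        Summable.tsum_finsetSum fun _ _ => ENNReal.summable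
    _ ≤ ∑ i ∈ Finset.range (M + 1), (ENNReal.ofReal (t ^ M))⁻¹ * m x :=
        Finset.sum_le_sum fun i _ => hq.tsum_level_le ht hm (n + i) x
    _ = _ := by rw [Finset.sum_const, Finset.card_range, nsmul_eq_mul]

lemma coe_le_add_ofReal_of_abs_sub_le {a b : ℝ≥0} {ε : ℝ} (h : |(a : ℝ) - b| ≤ ε) :
    (a : ℝ≥0∞) ≤ b + ENNReal.ofReal ε := by
  rw [← ENNReal.ofReal_coe_nnreal, ← ENNReal.ofReal_coe_nnreal,
    ← ENNReal.ofReal_add b.coe_nonneg ((abs_nonneg _).trans h)]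
  refine ENNReal.ofReal_le_ofReal ?_
  have := (abs_le.1 h).2
  linarith

lemma IsJumpWeight.isFlow [Nonempty W] (hq : IsJumpWeight M t q) (ht : 0 < t)
    (hm : ∀ x, m x = ∑' (w) (y), q (w :: y) * m (x ++ w :: y)) (hfin : ∀ x, m x ≠ ∞) :
    IsFlow m := by
  intro x
  set ρ : ℝ := 1 - t ^ (M + 1) with hρ
  have hρ0 : 0 ≤ ρ := sub_nonneg.2 (pow_le_one₀ ht.le hq.le_one)
  have hρ1 : ρ < 1 := by rw [hρ]; linarith [pow_pos ht (M + 1)]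
  set C : ℝ≥0∞ := (M + 1 : ℕ) * ((ENNReal.ofReal (t ^ M))⁻¹ * m x) with hC
  have hCtop : C ≠ ∞ := by
    refine ENNReal.mul_ne_top (ENNReal.natCast_ne_top _) (ENNReal.mul_ne_top ?_ (hfin x))
    rw [ENNReal.inv_ne_top]
    simpa using pow_pos ht M
  have hlim : Filter.Tendsto (fun n : ℕ => ENNReal.ofReal (ρ ^ n) * C) Filter.atTop (nhds 0) := by
    have h1 : Filter.Tendsto (fun n : ℕ => ENNReal.ofReal (ρ ^ n)) Filter.atTop (nhds 0) := by
      have := ENNReal.tendsto_ofReal (tendsto_pow_atTop_nhds_zero_of_lt_one hρ0 hρ1)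
      simpa using this
    simpa using ENNReal.Tendsto.mul_const h1 (Or.inr hCtop)
  -- Entrance from each child, reindexed by y = w :: y.tail so as to be compared word by word with
  -- entrance from x.
  have hS : ∀ n, ∑' w, m (x ++ [w]) =
      ∑' y : List W, (if y = [] then 0 else (firstEntrance q n y.tail : ℝ≥0∞)) * m (x ++ y) := by
    intro n
    rw [tsum_word_eq_nil_add]
    simp only [if_true, zero_mul, zero_add, reduceCtorEq, if_false, List.tail_cons]
    refine tsum_congr fun w => ?_
    rw [eq_tsum_firstEntrance hm n (x ++ [w])]
    simp
  have hlen : ∀ n, 0 < n → 1 ≤ n * (M + 1) := fun n hn => Nat.mul_pos hn (Nat.succ_pos _)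
  have hsupp : ∀ n, 0 < n → ∀ y : List W, y ≠ [] →
      firstEntrance q (n * (M + 1) - 1) y.tail ≠ 0 →
      n * (M + 1) ≤ y.length ∧ y.length ≤ n * (M + 1) + M := by
    intro n hn y hy h
    have h1 := hq.firstEntrance_support _ _ h
    have h2 := List.length_pos_of_ne_nil hy
    have h3 := hlen n hn
    rw [List.length_tail] at h1
    omega
  -- Entrance weights differ by at most ρ^n and live on a window of mass at most C, with C
  -- independent of n.
  have hupper : ∀ n, 0 < n → m x ≤ ∑' w, m (x ++ [w]) + ENNReal.ofReal (ρ ^ n) * C := by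
    intro n hn
    rw [hS (n * (M + 1) - 1)]
    refine le_trans ?_ (add_le_add_right
      (mul_le_mul_right (hq.tsum_window_le ht hm (n * (M + 1)) x) _) _)
    rw [← ENNReal.tsum_mul_left, ← ENNReal.tsum_add, eq_tsum_firstEntrance hm (n * (M + 1)) x]
    refine ENNReal.tsum_le_tsum fun y => ?_
    by_cases h : firstEntrance q (n * (M + 1)) y = 0
    · simp [h]
    · have h1 := hq.firstEntrance_support _ _ h
      have h2 : y ≠ [] := by
        rintro rfl
        have h3 := hlen n hn
        simp at h1
        omega
      rw [if_pos h1, if_neg h2, ← add_mul]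
      gcongr
      exact coe_le_add_ofReal_of_abs_sub_le (hq.abs_firstEntrance_sub_le ht n y h1.1 hn)
  have hlower : ∀ n, 0 < n → ∑' w, m (x ++ [w]) ≤ m x + ENNReal.ofReal (ρ ^ n) * C := by
    intro n hn
    rw [hS (n * (M + 1) - 1)]
    refine le_trans ?_ (add_le_add_right
      (mul_le_mul_right (hq.tsum_window_le ht hm (n * (M + 1)) x) _) _)
    rw [← ENNReal.tsum_mul_left]
    rw [eq_tsum_firstEntrance hm (n * (M + 1)) x]
    rw [← ENNReal.tsum_add]
    refine ENNReal.tsum_le_tsum fun y => ?_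
    by_cases hy : y = []
    · simp [hy]
    by_cases h : firstEntrance q (n * (M + 1) - 1) y.tail = 0
    · simp [h]
    · have h1 := hsupp n hn y hy h
      rw [if_pos h1, if_neg hy, ← add_mul]
      gcongr
      refine coe_le_add_ofReal_of_abs_sub_le ?_
      rw [abs_sub_comm]
      exact hq.abs_firstEntrance_sub_le ht n y h1.1 hn
  refine le_antisymm ?_ ?_
  · refine ge_of_tendsto (by simpa using tendsto_const_nhds.add hlim)
      (Filter.eventually_atTop.2 ⟨1, fun n hn => hupper n hn⟩)
  · refine ge_of_tendsto (by simpa using tendsto_const_nhds.add hlim)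
      (Filter.eventually_atTop.2 ⟨1, fun n hn => hlower n hn⟩)

/-- A jump weight which may also charge the empty word. -/
structure IsStoppingWeight (M : ℕ) (t : ℝ) (q : List W → ℝ≥0) : Prop where
  sum_eq_one : ∀ z : List W, M ≤ z.length → ∑ j ∈ Finset.range (M + 1), q (z.take j) = 1
  eq_zero : ∀ y : List W, M < y.length → q y = 0
  le_singleton : ∀ w : W, t ≤ q [w]

/-- For a bounded stopping weight, the finite harmonic densities are the flows. -/
theorem IsStoppingWeight.eq_tsum_iff_isFlow [Nonempty W] (hq : IsStoppingWeight M t q) (ht : 0 < t)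
    (hfin : ∀ x, m x ≠ ∞) : (∀ x, m x = ∑' y, q y * m (x ++ y)) ↔ IsFlow m := by
  refine ⟨fun h => ?_, fun h x => ?_⟩
  · obtain ⟨w₀⟩ := ‹Nonempty W›
    have hM : 0 < M := by
      by_contra hM
      have := hq.le_singleton w₀
      rw [hq.eq_zero [w₀] (by simp; omega)] at this
      exact absurd this (by simpa using ht)
    have hsum : ∀ z : List W, M ≤ z.length →
        q [] + ∑ j ∈ Finset.range M, q (z.take (j + 1)) = 1 := by
      intro z hz
      have := hq.sum_eq_one z hz
      rwa [Finset.sum_range_succ', List.take_zero, add_comm] at this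
    -- The one-letter mass, at least t > 0, is part of the complement of q [].
    have hr : q [] < 1 := by
      have h1 := hsum (List.replicate M w₀) (by simp)
      have h2 : q [w₀] ≤ ∑ j ∈ Finset.range M, q ((List.replicate M w₀).take (j + 1)) := by
        refine le_trans (le_of_eq ?_) (Finset.single_le_sum (fun _ _ => zero_le)
          (Finset.mem_range.2 hM))
        obtain ⟨M, rfl⟩ := Nat.exists_eq_add_of_lt hM
        simp [List.replicate_succ]
      have h3 : 0 < q [w₀] := by
        have := hq.le_singleton w₀
        exact_mod_cast ht.trans_le this
      rw [← h1]
      exact lt_add_of_pos_right _ (h3.trans_le h2)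
    set r : ℝ≥0 := 1 - q [] with hrdef
    have hr0 : r ≠ 0 := (tsub_pos_of_lt hr).ne'
    have hr1 : r ≤ 1 := tsub_le_self
    -- Conditioning on a nonempty jump divides by r ≤ 1, so the lower bound t survives.
    have hq' : IsJumpWeight M t fun y => q y / r := by
      refine ⟨fun z hz => ?_, fun y hy => ?_, fun w => (hq.le_singleton w).trans ?_⟩
      · rw [← Finset.sum_div, div_eq_one_iff_eq hr0, hrdef, ← hsum z hz, add_tsub_cancel_left]
      · rw [hq.eq_zero y hy, zero_div]
      · exact_mod_cast le_div_self zero_le (pos_iff_ne_zero.2 hr0) hr1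
    have : Nonempty W := ⟨w₀⟩
    refine hq'.isFlow ht (fun x => ?_) hfin
    have h1 := h x
    rw [tsum_word_eq_nil_add, List.append_nil] at h1
    have h2 : m x = q [] * m x + r * m x := by
      rw [← add_mul, ← ENNReal.coe_add, hrdef, add_tsub_cancel_of_le hr.le, ENNReal.coe_one,
        one_mul]
    have h3 : r * m x = ∑' (w) (y), q (w :: y) * m (x ++ w :: y) :=
      (ENNReal.add_right_inj (ENNReal.mul_ne_top ENNReal.coe_ne_top (hfin x))).1 (h2.symm.trans h1)
    have hr0' : (r : ℝ≥0∞) ≠ 0 := by exact_mod_cast hr0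
    rw [← ENNReal.mul_right_inj hr0' ENNReal.coe_ne_top, h3, ← ENNReal.tsum_mul_left]
    refine tsum_congr fun w => ?_
    rw [← ENNReal.tsum_mul_left]
    refine tsum_congr fun y => ?_
    rw [ENNReal.coe_div hr0, ← mul_assoc, ENNReal.mul_div_cancel hr0' ENNReal.coe_ne_top]
  · have := h.mul_eq_tsum M (fun y => (q y : ℝ≥0∞)) 1 ENNReal.one_ne_top
      (fun z hz => by exact_mod_cast hq.sum_eq_one z hz)
      (fun y hy => by exact_mod_cast hq.eq_zero y hy) x
    rwa [one_mul] at this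

end Core

/-! ### Locality of stopping times -/

section Locality

variable {G : Type*} [MeasurableSpace G] {Ω : Type*} [MeasurableSpace Ω]
  {τ : (ℕ → G) × Ω → WithTop ℕ}

/-- The event τ ≤ n is a preimage under restriction to the times 0, …, n. This holds for every path,
not just almost every one. -/
lemma IsRandomizedStoppingTime.le_congr (hτ : IsRandomizedStoppingTime τ) {x x' : ℕ → G} {n : ℕ}
    (h : ∀ k ≤ n, x k = x' k) (ω : Ω) (hx : τ (x, ω) ≤ n) : τ (x', ω) ≤ n := by
  obtain ⟨S, -, hS⟩ := hτ.isStoppingTime ω n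
  have h1 : Preorder.restrictLe (π := fun _ : ℕ => G) n x = Preorder.restrictLe n x' := by
    funext k
    exact h k k.2
  have h2 : x ∈ Preorder.restrictLe (π := fun _ : ℕ => G) n ⁻¹' S := by
    rw [hS]
    exact hx
  rw [Set.mem_preimage, h1, ← Set.mem_preimage, hS] at h2
  exact h2

lemma IsRandomizedStoppingTime.eq_of_eq (hτ : IsRandomizedStoppingTime τ) {x x' : ℕ → G} {n : ℕ}
    (h : ∀ k ≤ n, x k = x' k) (ω : Ω) {j : WithTop ℕ} (hj : j ≤ n) (hx : τ (x, ω) = j) :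
    τ (x', ω) = j := by
  lift j to ℕ using ne_top_of_le_ne_top (WithTop.coe_ne_top) hj
  have hj' : j ≤ n := WithTop.coe_le_coe.1 hj
  refine le_antisymm (hτ.le_congr (fun k hk => h k (hk.trans hj')) ω hx.le) ?_
  by_contra! hlt
  lift τ (x', ω) to ℕ using hlt.ne_top with i hi
  have hij : i < j := WithTop.coe_lt_coe.1 hlt
  have := hτ.le_congr (n := i) (fun k hk => (h k (by omega)).symm) ω hi.symm.le
  rw [hx] at this
  exact absurd (WithTop.coe_le_coe.1 this) hij.not_ge

lemma IsRandomizedStoppingTime.mem_iff (hτ : IsRandomizedStoppingTime τ) {x x' : ℕ → G} {n : ℕ}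
    (h : ∀ k ≤ n, x k = x' k) (ω : Ω) {S : Set (WithTop ℕ)} (hS : S ⊆ Set.Iic (n : WithTop ℕ)) :
    τ (x, ω) ∈ S ↔ τ (x', ω) ∈ S := by
  constructor
  · intro hx
    rwa [hτ.eq_of_eq h ω (hS hx) rfl]
  · intro hx
    rwa [hτ.eq_of_eq (fun k hk => (h k hk).symm) ω (hS hx) rfl]

end Locality

/-! ### Paths of the walk on the free semigroup -/

section Paths

variable {W : Type*}

lemma position_of_letters (w : ℕ → W) (n : ℕ) :
    position (fun i => FreeMonoid.of (w i)) n =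
      FreeMonoid.ofList (List.ofFn fun i : Fin n => w i) := by
  induction n with
  | zero => simp [position]
  | succ n ih =>
    rw [position, ih, List.ofFn_succ', List.concat_eq_append, FreeMonoid.ofList_append]
    rfl

/-- The path through the initial segments of a finite word. -/
def wordPath (y : List W) (k : ℕ) : FreeMonoid W :=
  FreeMonoid.ofList (y.take k)

lemma eq_wordPath_of_position_eq {w : ℕ → W} {n : ℕ} {y : List W}
    (h : position (fun i => FreeMonoid.of (w i)) n = FreeMonoid.ofList y) :
    y.length = n ∧ ∀ k ≤ n, position (fun i => FreeMonoid.of (w i)) k = wordPath y k := by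
  rw [position_of_letters] at h
  have hy : (List.ofFn fun i : Fin n => w i) = y := FreeMonoid.ofList.injective h
  subst hy
  refine ⟨List.length_ofFn, fun k hk => ?_⟩
  rw [position_of_letters, wordPath]
  congr 1
  apply List.ext_getElem
  · simp [hk]
  · intro i h1 h2
    simp

lemma wordWeight_eq_prod (μ : PMF (FreeMonoid W)) (y : List W) :
    wordWeight μ (FreeMonoid.ofList y) =
      ∏ i : Fin y.length, (μ (FreeMonoid.of (y.get i))).toReal := by
  conv_lhs => rw [← List.ofFn_get y]
  rw [wordWeight, FreeMonoid.toList_ofList, List.map_ofFn, List.prod_ofFn]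
  rfl

variable [Countable W]

instance : Countable (FreeMonoid W) := inferInstanceAs (Countable (List W))

lemma measurable_position : Measurable (position : (ℕ → FreeMonoid W) → ℕ → FreeMonoid W) := by
  refine measurable_pi_lambda _ fun n => ?_
  induction n with
  | zero => exact measurable_const
  | succ n ih =>
    exact (Measurable.of_discrete (f := fun p : FreeMonoid W × FreeMonoid W => p.1 * p.2)).comp
      (ih.prodMk (measurable_pi_apply n))

instance (μ : PMF (FreeMonoid W)) : IsProbabilityMeasure (pathMeasure μ) :=
  Measure.isProbabilityMeasure_map measurable_position.aemeasurable

variable {μ : PMF (FreeMonoid W)}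

lemma ae_increments (hμ : μ.support ⊆ Set.range (FreeMonoid.of : W → FreeMonoid W)) :
    ∀ᵐ h ∂(Measure.infinitePi fun _ : ℕ => μ.toMeasure),
      ∃ w : ℕ → W, h = fun i => FreeMonoid.of (w i) := by
  have h1 : ∀ᵐ g ∂μ.toMeasure, g ∈ Set.range (FreeMonoid.of : W → FreeMonoid W) := by
    rw [ae_iff]
    change μ.toMeasure (Set.range FreeMonoid.of)ᶜ = 0
    rw [PMF.toMeasure_apply_eq_zero_iff _ (Set.to_countable _).measurableSet]
    exact Set.disjoint_compl_right_iff_subset.2 hμ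
  have h2 : ∀ i : ℕ, ∀ᵐ h ∂(Measure.infinitePi fun _ : ℕ => μ.toMeasure),
      h i ∈ Set.range (FreeMonoid.of : W → FreeMonoid W) := fun i =>
    (measurePreserving_eval_infinitePi (fun _ : ℕ => μ.toMeasure) i).quasiMeasurePreserving.ae h1
  filter_upwards [ae_all_iff.2 h2] with h hh
  choose w hw using hh
  exact ⟨w, funext fun i => (hw i).symm⟩

/-- This is where freeness enters: almost surely each increment is one letter, so the present
position records the whole past. -/
lemma ae_path (hμ : μ.support ⊆ Set.range (FreeMonoid.of : W → FreeMonoid W)) :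
    ∀ᵐ x ∂(pathMeasure μ), ∀ (n : ℕ) (y : List W), x n = FreeMonoid.ofList y →
      y.length = n ∧ ∀ k ≤ n, x k = wordPath y k := by
  refine ae_all_iff.2 fun n => ae_all_iff.2 fun y => ?_
  have hmeas : ∀ k (z : List W), Measurable fun x : ℕ → FreeMonoid W => x k = FreeMonoid.ofList z :=
    fun k z => (Measurable.of_discrete (f := fun g => g = FreeMonoid.ofList z)).comp
      (measurable_pi_apply k)
  rw [pathMeasure, ae_map_iff measurable_position.aemeasurable]
  · filter_upwards [ae_increments hμ] with h hh
    obtain ⟨w, rfl⟩ := hh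
    exact eq_wordPath_of_position_eq
  · exact measurableSet_setOfPred.2 ((hmeas n y).imp (measurable_const.and
      (Measurable.forall fun k => measurable_const.imp (hmeas k _))))

lemma pathMeasure_eq_word (hμ : μ.support ⊆ Set.range (FreeMonoid.of : W → FreeMonoid W))
    (y : List W) : (pathMeasure μ) {x | x y.length = FreeMonoid.ofList y} =
      ENNReal.ofReal (wordWeight μ (FreeMonoid.ofList y)) := by
  have hmeas : MeasurableSet {x : ℕ → FreeMonoid W | x y.length = FreeMonoid.ofList y} :=
    measurable_pi_apply _ (measurableSet_singleton _)
  rw [pathMeasure, Measure.map_apply measurable_position hmeas]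
  -- The default 1 is never used: only coordinates below the length of y are constrained.
  let v : ℕ → FreeMonoid W := fun i => if h : i < y.length then FreeMonoid.of y[i] else 1
  have h1 : position ⁻¹' {x : ℕ → FreeMonoid W | x y.length = FreeMonoid.ofList y}
      =ᵐ[Measure.infinitePi fun _ : ℕ => μ.toMeasure]
      (Set.pi (Finset.range y.length : Set ℕ) fun i => {v i}) := by
    filter_upwards [ae_increments hμ] with h hh
    obtain ⟨w, rfl⟩ := hh
    refine propext ?_
    change position _ _ = _ ↔ _
    rw [position_of_letters, FreeMonoid.ofList.injective.eq_iff]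
    constructor
    · intro he i hi
      have hi' : i < y.length := by simpa using hi
      have h2 : y[i] = w i := by
        have : y[i]? = some (w i) := by
          rw [← he]
          simp [hi']
        rwa [List.getElem?_eq_getElem hi', Option.some_inj] at this
      simp [v, hi', h2]
    · intro he
      apply List.ext_getElem
      · simp
      · intro i h1 h2
        have := he i (by simpa using h2)
        simp only [v, dif_pos h2, Set.mem_singleton_iff] at this
        simpa using FreeMonoid.of_injective this
  rw [measure_congr h1, Measure.infinitePi_pi _ fun i _ => measurableSet_singleton _,
    wordWeight_eq_prod, ENNReal.ofReal_prod_of_nonneg fun _ _ => ENNReal.toReal_nonneg,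
    Finset.prod_range]
  refine Finset.prod_congr rfl fun i _ => ?_
  rw [PMF.toMeasure_apply_singleton _ _ (measurableSet_singleton _),
    ENNReal.ofReal_toReal (PMF.apply_ne_top _ _)]
  simp [v]

end Paths

/-! ### The stopped law -/

section Stopped

variable {W : Type*} {μ : PMF (FreeMonoid W)} {Ω : Type*} [MeasurableSpace Ω]
  {lam : Measure Ω} {τ : (ℕ → FreeMonoid W) × Ω → WithTop ℕ}

lemma measurableSet_stop (hτ : IsRandomizedStoppingTime τ) (x : ℕ → FreeMonoid W)
    (S : Set (WithTop ℕ)) : MeasurableSet {ω | τ (x, ω) ∈ S} :=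
  (hτ.measurable.comp measurable_prodMk_left) (Set.to_countable S).measurableSet

variable [Countable W] [IsProbabilityMeasure lam]

/-- Passing through y fixes the path up to time |y|, so by locality the stopping event depends on ω
alone and the product measure splits. -/
lemma prod_measure_stop (hμ : μ.support ⊆ Set.range (FreeMonoid.of : W → FreeMonoid W))
    (hτ : IsRandomizedStoppingTime τ) (y : List W) {S : Set (WithTop ℕ)}
    (hS : S ⊆ Set.Iic (y.length : WithTop ℕ)) :
    ((pathMeasure μ).prod lam) {p | p.1 y.length = FreeMonoid.ofList y ∧ τ p ∈ S} =
      ENNReal.ofReal (wordWeight μ (FreeMonoid.ofList y)) * lam {ω | τ (wordPath y, ω) ∈ S} := by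
  rw [← pathMeasure_eq_word hμ, ← Measure.prod_prod]
  refine measure_congr ?_
  filter_upwards [Measure.quasiMeasurePreserving_fst.ae (ae_path hμ)] with p hp
  refine propext ?_
  change (_ ∧ _) ↔ (_ ∧ _)
  refine and_congr_right fun h => ?_
  exact hτ.mem_iff (hp _ _ h).2 p.2 hS

/-- The conditional probability of stopping at the word `y` when the path goes through `y`. -/
def stopWeight (lam : Measure Ω) (τ : (ℕ → FreeMonoid W) × Ω → WithTop ℕ) (y : List W) : ℝ≥0 :=
  (lam {ω | τ (wordPath y, ω) ∈ ({(y.length : WithTop ℕ)} : Set (WithTop ℕ))}).toNNReal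

lemma stoppedLaw_eq (hμ : μ.support ⊆ Set.range (FreeMonoid.of : W → FreeMonoid W))
    (hτ : IsRandomizedStoppingTime τ) (y : List W) :
    stoppedLaw μ lam τ (FreeMonoid.ofList y) =
      wordWeight μ (FreeMonoid.ofList y) * stopWeight lam τ y := by
  have hw : 0 ≤ wordWeight μ (FreeMonoid.ofList y) := by
    rw [wordWeight_eq_prod]
    exact Finset.prod_nonneg fun _ _ => ENNReal.toReal_nonneg
  have h1 : {p : (ℕ → FreeMonoid W) × Ω | ∃ n : ℕ, τ p = (n : WithTop ℕ) ∧
      p.1 n = FreeMonoid.ofList y} =ᵐ[(pathMeasure μ).prod lam]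
      {p | p.1 y.length = FreeMonoid.ofList y ∧
        τ p ∈ ({(y.length : WithTop ℕ)} : Set (WithTop ℕ))} := by
    filter_upwards [Measure.quasiMeasurePreserving_fst.ae (ae_path hμ)] with p hp
    refine propext ⟨?_, ?_⟩
    · rintro ⟨n, hn, h⟩
      obtain rfl := (hp n y h).1
      exact ⟨h, hn⟩
    · rintro ⟨h, hn⟩
      exact ⟨y.length, hn, h⟩
  rw [stoppedLaw, measureReal_congr h1, Measure.real,
    prod_measure_stop hμ hτ y (by simp), ENNReal.toReal_mul, ENNReal.toReal_ofReal hw]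
  rfl

/-- The almost sure bound on τ transfers to the single path `wordPath z` only because the walk
passes through z with positive probability. -/
lemma measure_stop_le_eq_one (hμ : μ.support ⊆ Set.range (FreeMonoid.of : W → FreeMonoid W))
    (hτ : IsRandomizedStoppingTime τ) {M : ℕ}
    (hM : ∀ᵐ p ∂((pathMeasure μ).prod lam), τ p ≤ (M : WithTop ℕ)) {z : List W}
    (hz : M ≤ z.length) (hw : 0 < wordWeight μ (FreeMonoid.ofList z)) :
    lam {ω | τ (wordPath z, ω) ∈ Set.Iic (M : WithTop ℕ)} = 1 := by
  have h1 := prod_measure_stop (lam := lam) hμ hτ z (S := Set.Iic (M : WithTop ℕ))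
    (Set.Iic_subset_Iic.2 (by exact_mod_cast hz))
  have h2 : {p : (ℕ → FreeMonoid W) × Ω | p.1 z.length = FreeMonoid.ofList z ∧
      τ p ∈ Set.Iic (M : WithTop ℕ)} =ᵐ[(pathMeasure μ).prod lam]
      {x | x z.length = FreeMonoid.ofList z} ×ˢ Set.univ := by
    filter_upwards [hM] with p hp
    refine propext ?_
    change (_ ∧ _) ↔ (_ ∧ _)
    exact and_congr_right fun _ => ⟨fun _ => trivial, fun _ => hp⟩
  rw [measure_congr h2, Measure.prod_prod, measure_univ, pathMeasure_eq_word hμ] at h1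
  exact ((ENNReal.mul_right_inj (by simpa using hw) ENNReal.ofReal_ne_top).1 h1).symm

/-- By locality, stopping at each prefix can be read off the one path `wordPath z`, where the events
τ = j, j ≤ M, partition almost all of Ω. -/
lemma sum_stopWeight (hμ : μ.support ⊆ Set.range (FreeMonoid.of : W → FreeMonoid W))
    (hτ : IsRandomizedStoppingTime τ) {M : ℕ}
    (hM : ∀ᵐ p ∂((pathMeasure μ).prod lam), τ p ≤ (M : WithTop ℕ)) {z : List W}
    (hz : M ≤ z.length) (hw : 0 < wordWeight μ (FreeMonoid.ofList z)) :
    ∑ j ∈ Finset.range (M + 1), stopWeight lam τ (z.take j) = 1 := by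
  have h1 : ∀ j ∈ Finset.range (M + 1), stopWeight lam τ (z.take j) =
      (lam {ω | τ (wordPath z, ω) ∈ ({(j : WithTop ℕ)} : Set (WithTop ℕ))}).toNNReal := by
    intro j hj
    rw [Finset.mem_range] at hj
    have hlen : (z.take j).length = j := by rw [List.length_take]; omega
    rw [stopWeight, hlen]
    congr 2
    ext ω
    refine hτ.mem_iff (n := j) (fun k hk => ?_) ω (Set.singleton_subset_iff.2 (Set.mem_Iic.2 le_rfl))
    rw [wordPath, wordPath, List.take_take, min_eq_left hk]
  rw [Finset.sum_congr rfl h1, ← ENNReal.toNNReal_sum fun _ _ => measure_ne_top _ _,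
    ← measure_biUnion_finset]
  · rw [← ENNReal.toNNReal_one, ← measure_stop_le_eq_one hμ hτ hM hz hw]
    congr 2
    ext ω
    simp only [Set.mem_iUnion, Set.mem_ofPred_eq, Set.mem_singleton_iff, Finset.mem_range,
      Set.mem_Iic, exists_prop]
    constructor
    · rintro ⟨j, hj, h⟩
      rw [h]
      exact_mod_cast Nat.lt_succ_iff.1 hj
    · intro h
      lift τ (wordPath z, ω) to ℕ using ne_top_of_le_ne_top WithTop.coe_ne_top h with i
      exact ⟨i, Nat.lt_succ_iff.2 (WithTop.coe_le_coe.1 h), rfl⟩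
  · intro i _ j _ hij
    refine Set.disjoint_left.2 fun ω hi hj => hij ?_
    have : (i : WithTop ℕ) = j := Eq.trans (Eq.symm hi) hj
    exact_mod_cast this
  · exact fun j _ => measurableSet_stop hτ _ _

lemma stopWeight_eq_zero (hμ : μ.support ⊆ Set.range (FreeMonoid.of : W → FreeMonoid W))
    (hτ : IsRandomizedStoppingTime τ) {M : ℕ}
    (hM : ∀ᵐ p ∂((pathMeasure μ).prod lam), τ p ≤ (M : WithTop ℕ)) {y : List W}
    (hy : M < y.length) (hw : 0 < wordWeight μ (FreeMonoid.ofList y)) :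
    stopWeight lam τ y = 0 := by
  have h1 := measure_stop_le_eq_one hμ hτ hM hy.le hw
  rw [← prob_compl_eq_zero_iff (measurableSet_stop hτ _ _)] at h1
  rw [stopWeight, measure_mono_null _ h1, ENNReal.toNNReal_zero]
  intro ω hω
  change ¬ (τ (wordPath y, ω) ≤ M)
  rw [show τ (wordPath y, ω) = y.length from hω]
  exact_mod_cast not_le.2 hy

end Stopped

/-! ### Flows on the tree of words -/

section Flows

variable {W : Type*} {m m₁ : List W → ℝ≥0∞}

lemma IsFlow.append_le (hm : IsFlow m) (x y : List W) : m (x ++ y) ≤ m x := by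
  induction y generalizing x with
  | nil => rw [List.append_nil]
  | cons w y ih =>
    rw [List.append_cons]
    refine (ih (x ++ [w])).trans ?_
    rw [hm x]
    exact ENNReal.le_tsum w

lemma IsFlow.sub (hm : IsFlow m) (hm₁ : IsFlow m₁) (hle : ∀ x, m₁ x ≤ m x)
    (hfin : ∀ x, m x ≠ ∞) : IsFlow fun x => m x - m₁ x := by
  intro x
  have h1 : m₁ x + (m x - m₁ x) = m₁ x + ∑' w, (m (x ++ [w]) - m₁ (x ++ [w])) := by
    rw [add_tsub_cancel_of_le (hle x), hm x]
    nth_rw 1 [hm₁ x]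
    rw [← ENNReal.tsum_add]
    exact tsum_congr fun w => (add_tsub_cancel_of_le (hle _)).symm
  exact (ENNReal.add_right_inj (ne_top_of_le_ne_top (hfin x) (hle x))).1 h1

open Classical in
/-- The part of the flow `m` which passes through the word `v`. -/
noncomputable def cylinderFlow (m : List W → ℝ≥0∞) (v x : List W) : ℝ≥0∞ :=
  if v <+: x then m x else if x <+: v then m v else 0

lemma cylinderFlow_le (hm : IsFlow m) (v x : List W) : cylinderFlow m v x ≤ m x := by
  rw [cylinderFlow]
  split_ifs with h1 h2
  · exact le_rfl
  · obtain ⟨y, rfl⟩ := h2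
    exact hm.append_le x y
  · exact zero_le

lemma cylinderFlow_nil (v : List W) : cylinderFlow m v [] = m v := by
  rw [cylinderFlow]
  split_ifs with h1 h2
  · rw [List.prefix_nil.1 h1]
  · rfl
  · exact absurd List.nil_prefix h2

lemma cylinderFlow_self (v : List W) : cylinderFlow m v v = m v := by
  rw [cylinderFlow, if_pos List.prefix_rfl]

lemma cylinderFlow_of_prefix {v x : List W} (h : x <+: v) : cylinderFlow m v x = m v := by
  rw [cylinderFlow]
  split_ifs with h1
  · rw [h.eq_of_length_le h1.length_le]
  · rfl

lemma isFlow_cylinderFlow (hm : IsFlow m) (v : List W) : IsFlow (cylinderFlow m v) := by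
  intro x
  by_cases h1 : v <+: x
  · rw [cylinderFlow, if_pos h1, hm x]
    refine tsum_congr fun w => ?_
    rw [cylinderFlow, if_pos (h1.trans (List.prefix_append _ _))]
  by_cases h2 : x <+: v
  · rw [cylinderFlow_of_prefix h2]
    obtain ⟨y, rfl⟩ := h2
    cases y with
    | nil => simp at h1
    | cons w₀ y =>
      have hp : ∀ w, x ++ [w] <+: x ++ w₀ :: y ↔ w = w₀ := by
        intro w
        rw [List.prefix_append_right_inj, List.cons_prefix_cons]
        simp
      rw [tsum_eq_single w₀, cylinderFlow_of_prefix ((hp w₀).2 rfl)]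
      intro w hw
      rw [cylinderFlow, if_neg, if_neg (mt (hp w).1 hw)]
      intro h
      rw [List.prefix_append_right_inj, List.cons_prefix_cons] at h
      exact hw h.1.symm
  · rw [cylinderFlow, if_neg h1, if_neg h2, eq_comm, ENNReal.tsum_eq_zero]
    intro w
    have h4 : ¬ v <+: x ++ [w] := by
      rw [List.prefix_concat_iff]
      rintro (h | h)
      · exact h2 (h ▸ List.prefix_append _ _)
      · exact h1 h
    rw [cylinderFlow, if_neg h4, if_neg fun h => h2 ((List.prefix_append _ _).trans h)]

lemma isInitialSegment_nil (g : ℕ → W) : IsInitialSegment (FreeMonoid.ofList []) g :=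
  ⟨0, by simp⟩

lemma isInitialSegment_iff {x : List W} {g : ℕ → W} :
    IsInitialSegment (FreeMonoid.ofList x) g ↔ x = List.ofFn fun i : Fin x.length => g i := by
  constructor
  · rintro ⟨n, hn⟩
    have hx : x = List.ofFn fun i : Fin n => g i := FreeMonoid.ofList.injective hn
    have hn : x.length = n := by rw [hx, List.length_ofFn]
    subst hn
    exact hx
  · exact fun h => ⟨x.length, congrArg FreeMonoid.ofList h⟩

lemma isInitialSegment_concat {x : List W} {w : W} {g : ℕ → W} :
    IsInitialSegment (FreeMonoid.ofList (x ++ [w])) g ↔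
      IsInitialSegment (FreeMonoid.ofList x) g ∧ w = g x.length := by
  have hlen : (x ++ [w]).length = x.length + 1 := by simp
  constructor
  · rintro ⟨n, hn⟩
    have hx : x ++ [w] = List.ofFn fun i : Fin n => g i := FreeMonoid.ofList.injective hn
    have hn : x.length + 1 = n := by rw [← hlen, hx, List.length_ofFn]
    subst hn
    rw [List.ofFn_succ', List.concat_eq_append] at hx
    obtain ⟨h1, h2⟩ := List.append_inj' hx rfl
    exact ⟨isInitialSegment_iff.2 h1, by simpa using h2⟩
  · rintro ⟨h1, h2⟩
    refine ⟨x.length + 1, ?_⟩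
    rw [List.ofFn_succ', List.concat_eq_append, h2]
    congr 2
    exact isInitialSegment_iff.1 h1

open Classical in
/-- The unit flow along an infinite word. -/
noncomputable def rayFlow (g : ℕ → W) (x : List W) : ℝ≥0∞ :=
  if IsInitialSegment (FreeMonoid.ofList x) g then 1 else 0

lemma tsum_eq_of_ray {g : ℕ → W} (h0 : ∀ x, ¬ IsInitialSegment (FreeMonoid.ofList x) g → m x = 0)
    (x : List W) : ∑' w, m (x ++ [w]) = m (x ++ [g x.length]) := by
  refine tsum_eq_single _ fun w hw => h0 _ ?_
  rw [isInitialSegment_concat]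
  exact fun h => hw h.2

lemma isFlow_rayFlow (g : ℕ → W) : IsFlow (rayFlow g) := by
  intro x
  rw [tsum_eq_of_ray (g := g) (fun y hy => by rw [rayFlow, if_neg hy])]
  have h := isInitialSegment_concat (x := x) (w := g x.length) (g := g)
  by_cases hx : IsInitialSegment (FreeMonoid.ofList x) g
  · rw [rayFlow, rayFlow, if_pos hx, if_pos (h.2 ⟨hx, rfl⟩)]
  · rw [rayFlow, rayFlow, if_neg hx, if_neg fun h' => hx (h.1 h').1]

/-- A flow carried by an infinite word is a multiple of the unit flow. -/
lemma IsFlow.eq_mul_rayFlow (hm : IsFlow m) {g : ℕ → W}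
    (h0 : ∀ x, ¬ IsInitialSegment (FreeMonoid.ofList x) g → m x = 0) (x : List W) :
    m x = m [] * rayFlow g x := by
  by_cases hx : IsInitialSegment (FreeMonoid.ofList x) g
  · rw [rayFlow, if_pos hx, mul_one]
    induction x using List.reverseRecOn with
    | nil => rfl
    | append_singleton x w ih =>
      obtain ⟨h1, rfl⟩ := isInitialSegment_concat.1 hx
      rw [← ih h1, hm x, tsum_eq_of_ray h0]
  · rw [rayFlow, if_neg hx, mul_zero, h0 x hx]

/-- The initial segments of the infinite word built by successive choice of letters. -/
def raySegment (next : List W → W) : ℕ → List W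
  | 0 => []
  | n + 1 => raySegment next n ++ [next (raySegment next n)]

lemma raySegment_eq_ofFn (next : List W → W) (n : ℕ) :
    raySegment next n = List.ofFn fun i : Fin n => next (raySegment next i) := by
  induction n with
  | zero => rfl
  | succ n ih => rw [List.ofFn_succ', List.concat_eq_append, raySegment, ih]; simp [← ih]

/-- An extremal unit flow is the unit flow along an infinite word. -/
lemma IsFlow.exists_eq_rayFlow (hm : IsFlow m) (hfin : ∀ x, m x ≠ ∞) (h1 : m [] = 1)
    (hext : ∀ m₁, IsFlow m₁ → (∀ x, m₁ x ≤ m x) → ∀ x, m₁ x = m₁ [] * m x) :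
    ∃ g : ℕ → W, m = rayFlow g := by
  -- Extremality applied to the part of m through v, evaluated at v, gives m v = m v * m v.
  have h01 : ∀ v, m v ≠ 0 → m v = 1 := by
    intro v hv
    have h := hext _ (isFlow_cylinderFlow hm v) (cylinderFlow_le hm v) v
    rw [cylinderFlow_self, cylinderFlow_nil] at h
    exact (ENNReal.mul_right_inj hv (hfin v)).1 (by rw [mul_one]; exact h.symm)
  have hnext : ∀ x, ∃ w, m x ≠ 0 → m (x ++ [w]) ≠ 0 := by
    intro x
    by_cases hx : m x = 0
    · have : ∃ w : W, m ([] ++ [w]) ≠ 0 := by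
        by_contra! h
        have := hm []
        rw [ENNReal.tsum_eq_zero.2 h, h1] at this
        exact one_ne_zero this
      exact ⟨this.choose, fun h => absurd hx h⟩
    · by_contra! h
      refine hx ?_
      rw [hm x, ENNReal.tsum_eq_zero]
      exact fun w => (h w).2
  choose next hnext using hnext
  have hray : ∀ n, m (raySegment next n) ≠ 0 := by
    intro n
    induction n with
    | zero => rw [raySegment, h1]; exact one_ne_zero
    | succ n ih => exact hnext _ ih
  refine ⟨fun n => next (raySegment next n), ?_⟩
  funext x
  -- The ray flow lies below m, since m is 1 along the ray; extremality and the common value 1 at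
  -- the root make them equal.
  rw [hext _ (isFlow_rayFlow fun n => next (raySegment next n))]
  · rw [rayFlow, if_pos (isInitialSegment_nil _), one_mul]
  · intro x
    rw [rayFlow]
    split_ifs with hx
    · have h2 := isInitialSegment_iff.1 hx
      rw [← raySegment_eq_ofFn] at h2
      rw [h2, h01 _ (hray _)]
    · exact zero_le

end Flows

/-! ### Harmonic functions and flows -/

section Harmonic

variable {W : Type*} {μ : PMF (FreeMonoid W)}

lemma wordWeight_nonneg (x : FreeMonoid W) : 0 ≤ wordWeight μ x := by
  refine List.prod_nonneg fun a ha => ?_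
  obtain ⟨w, -, rfl⟩ := List.mem_map.1 ha
  exact ENNReal.toReal_nonneg

lemma wordWeight_one : wordWeight μ 1 = 1 := by
  simp [wordWeight]

lemma wordWeight_mul (x y : FreeMonoid W) :
    wordWeight μ (x * y) = wordWeight μ x * wordWeight μ y := by
  simp [wordWeight]

lemma wordWeight_of (w : W) : wordWeight μ (FreeMonoid.of w) = (μ (FreeMonoid.of w)).toReal := by
  simp [wordWeight]

lemma hasSum_iff_tsum_ofReal {ι : Type*} {F : ι → ℝ} {s : ℝ} (hF : ∀ i, 0 ≤ F i) (hs : 0 ≤ s) :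
    HasSum F s ↔ ENNReal.ofReal s = ∑' i, ENNReal.ofReal (F i) := by
  constructor
  · intro h
    rw [← h.tsum_eq, ENNReal.ofReal_tsum_of_nonneg hF h.summable]
  · intro h
    have hsum : Summable F := by
      have h1 : ∑' i, ENNReal.ofReal (F i) ≠ ∞ := by rw [← h]; exact ENNReal.ofReal_ne_top
      have h2 := ENNReal.summable_toReal h1
      simpa only [ENNReal.toReal_ofReal (hF _)] using h2
    rw [← ENNReal.ofReal_tsum_of_nonneg hF hsum,
      ENNReal.ofReal_eq_ofReal_iff hs (tsum_nonneg hF)] at h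
    rw [h]
    exact hsum.hasSum

/-- The density `f(x) μ^{|x|}(x)` of a function on words. -/
noncomputable def density (μ : PMF (FreeMonoid W)) (f : FreeMonoid W → ℝ) (x : List W) : ℝ≥0∞ :=
  ENNReal.ofReal (f (FreeMonoid.ofList x) * wordWeight μ (FreeMonoid.ofList x))

/-- The function with a given density. -/
noncomputable def ofDensity (μ : PMF (FreeMonoid W)) (m : List W → ℝ≥0∞) (x : FreeMonoid W) : ℝ :=
  (m x.toList).toReal / wordWeight μ x

lemma density_ofDensity {m : List W → ℝ≥0∞} (hfin : ∀ x, m x ≠ ∞)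
    (hnull : ∀ x, wordWeight μ (FreeMonoid.ofList x) = 0 → m x = 0) :
    density μ (ofDensity μ m) = m := by
  funext x
  by_cases hx : wordWeight μ (FreeMonoid.ofList x) = 0
  · rw [density, hx, mul_zero, ENNReal.ofReal_zero, hnull x hx]
  · rw [density, ofDensity, div_mul_cancel₀ _ hx, FreeMonoid.toList_ofList,
      ENNReal.ofReal_toReal (hfin x)]

lemma ofDensity_density {f : FreeMonoid W → ℝ} (hf : ∀ x, 0 ≤ f x)
    (hnull : ∀ x, wordWeight μ x = 0 → f x = 0) : ofDensity μ (density μ f) = f := by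
  funext x
  rw [ofDensity, density, FreeMonoid.ofList_toList,
    ENNReal.toReal_ofReal (mul_nonneg (hf x) (wordWeight_nonneg x))]
  by_cases hx : wordWeight μ x = 0
  · rw [hx, mul_zero, zero_div, hnull x hx]
  · rw [mul_div_cancel_right₀ _ hx]

lemma ofDensity_rayFlow (g : ℕ → W) :
    ofDensity μ (rayFlow g) = fun x => martinKernel μ x g := by
  funext x
  rw [ofDensity, rayFlow, martinKernel, FreeMonoid.ofList_toList]
  split_ifs <;> simp

variable {M : ℕ} {t : ℝ} {q : List W → ℝ≥0} {ν : FreeMonoid W → ℝ}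

/-- Multiplying the harmonic identity at x by the weight of x turns it into the identity for
densities, weights being multiplicative. At null x both sides vanish. -/
lemma isHarmonic_iff_isFlow [Nonempty W] (hq : IsStoppingWeight M t q) (ht : 0 < t)
    (hν : ∀ y, ν (FreeMonoid.ofList y) = wordWeight μ (FreeMonoid.ofList y) * q y)
    {f : FreeMonoid W → ℝ} (hf : ∀ x, 0 ≤ f x) (hnull : ∀ x, wordWeight μ x = 0 → f x = 0) :
    IsHarmonic ν f ↔ IsFlow (density μ f) := by
  rw [← hq.eq_tsum_iff_isFlow (m := density μ f) ht fun x => ENNReal.ofReal_ne_top, IsHarmonic,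
    ← FreeMonoid.ofList.forall_congr_right]
  refine forall_congr' fun x => ?_
  have hν0 : ∀ y, 0 ≤ ν (FreeMonoid.ofList y) := fun y => by
    rw [hν]
    exact mul_nonneg (wordWeight_nonneg _) (NNReal.coe_nonneg _)
  rw [hasSum_iff_tsum_ofReal (F := fun y => f (FreeMonoid.ofList x * y) * ν y)
      (fun y => mul_nonneg (hf _) (hν0 y.toList)) (hf _),
    ← FreeMonoid.ofList.tsum_eq]
  by_cases hx : wordWeight μ (FreeMonoid.ofList x) = 0
  · have h0 : ∀ y, wordWeight μ (FreeMonoid.ofList x * FreeMonoid.ofList y) = 0 := fun y => by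
      rw [wordWeight_mul, hx, zero_mul]
    simp [density, hx, h0, hnull]
  · have hpos : ENNReal.ofReal (wordWeight μ (FreeMonoid.ofList x)) ≠ 0 := by
      rw [ENNReal.ofReal_ne_zero_iff]
      exact (wordWeight_nonneg _).lt_of_ne' hx
    rw [← ENNReal.mul_right_inj hpos ENNReal.ofReal_ne_top, ← ENNReal.tsum_mul_left]
    refine Eq.congr ?_ (tsum_congr fun y => ?_)
    · rw [← ENNReal.ofReal_mul (wordWeight_nonneg _), density, mul_comm]
    · rw [← ENNReal.ofReal_mul (wordWeight_nonneg _), density, hν, FreeMonoid.ofList_append,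
        wordWeight_mul, ← ENNReal.ofReal_coe_nnreal, ← ENNReal.ofReal_mul (NNReal.coe_nonneg _)]
      congr 1
      ring

lemma ofDensity_mem_positiveHarmonic [Nonempty W] (hq : IsStoppingWeight M t q) (ht : 0 < t)
    (hν : ∀ y, ν (FreeMonoid.ofList y) = wordWeight μ (FreeMonoid.ofList y) * q y)
    {m : List W → ℝ≥0∞} (hm : IsFlow m) (hfin : ∀ x, m x ≠ ∞)
    (hnull : ∀ x, wordWeight μ (FreeMonoid.ofList x) = 0 → m x = 0) :
    ofDensity μ m ∈ positiveHarmonic ν := by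
  have h0 : ∀ x, 0 ≤ ofDensity μ m x := fun x =>
    div_nonneg ENNReal.toReal_nonneg (wordWeight_nonneg x)
  refine ⟨h0, (isHarmonic_iff_isFlow hq ht hν h0 fun x hx => ?_).2 ?_⟩
  · rw [ofDensity, hx, div_zero]
  · rwa [density_ofDensity hfin hnull]

/-- The restriction of a harmonic function to the words of weight zero, or to the other words, is
harmonic. -/
lemma IsHarmonic.restrict
    (hν : ∀ y, ν (FreeMonoid.ofList y) = wordWeight μ (FreeMonoid.ofList y) * q y)
    {f : FreeMonoid W → ℝ} (hf : IsHarmonic ν f) (P : Prop) [Decidable P] :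
    IsHarmonic ν fun x => if (wordWeight μ x = 0 ↔ P) then f x else 0 := by
  intro x
  -- A jump charged by ν has nonzero weight, so it preserves both the null words and their
  -- complement.
  have key : ∀ y, (if (wordWeight μ (x * y) = 0 ↔ P) then f (x * y) else 0) * ν y =
      if (wordWeight μ x = 0 ↔ P) then f (x * y) * ν y else 0 := by
    intro y
    by_cases hy : wordWeight μ y = 0
    · have : ν y = 0 := by
        rw [← FreeMonoid.ofList_toList y, hν, FreeMonoid.ofList_toList, hy, zero_mul]
      simp [this]
    · have : wordWeight μ (x * y) = 0 ↔ wordWeight μ x = 0 := by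
        rw [wordWeight_mul, mul_eq_zero, or_iff_left hy]
      simp only [this, ite_mul, zero_mul]
  simp only [key]
  split_ifs
  · exact hf x
  · exact hasSum_zero

/-- The part of u on null words is a harmonic summand, hence c • u; it vanishes at the identity,
where u is 1, so c = 0. -/
lemma IsMinimalHarmonic.eq_zero_of_wordWeight_eq_zero
    (hν : ∀ y, ν (FreeMonoid.ofList y) = wordWeight μ (FreeMonoid.ofList y) * q y)
    {u : FreeMonoid W → ℝ} (hu : IsMinimalHarmonic ν u) {x : FreeMonoid W}
    (hx : wordWeight μ x = 0) : u x = 0 := by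
  classical
  obtain ⟨⟨h0, hh⟩, h1, hmin⟩ := hu
  obtain ⟨⟨c, hc⟩, -⟩ := hmin (fun x => if (wordWeight μ x = 0 ↔ True) then u x else 0)
    ⟨fun x => by dsimp only; split_ifs; exacts [h0 x, le_rfl], hh.restrict hν True⟩
    (fun x => if (wordWeight μ x = 0 ↔ False) then u x else 0)
    ⟨fun x => by dsimp only; split_ifs; exacts [h0 x, le_rfl], hh.restrict hν False⟩
    (by
      funext y
      by_cases hy : wordWeight μ y = 0 <;> simp [hy])
  have hc0 : c = 0 := by
    have := congrFun hc 1
    simpa [wordWeight_one, h1] using this.symm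
  have := congrFun hc x
  simpa [hx, hc0] using this

/-- The minimal harmonic functions are the Martin kernels at infinite words. -/
theorem isMinimalHarmonic_iff [Nonempty W] (hq : IsStoppingWeight M t q) (ht : 0 < t)
    (hν : ∀ y, ν (FreeMonoid.ofList y) = wordWeight μ (FreeMonoid.ofList y) * q y)
    (u : FreeMonoid W → ℝ) : IsMinimalHarmonic ν u ↔ ∃ g : ℕ → W,
      (∀ n, 0 < μ (FreeMonoid.of (g n))) ∧ u = fun x => martinKernel μ x g := by
  constructor
  · intro hu
    have hnull : ∀ x, wordWeight μ x = 0 → u x = 0 := fun x =>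
      hu.eq_zero_of_wordWeight_eq_zero hν
    obtain ⟨⟨h0, hh⟩, h1, hmin⟩ := hu
    set m := density μ u with hm
    have hflow : IsFlow m := (isHarmonic_iff_isFlow hq ht hν h0 hnull).1 hh
    have hfin : ∀ x, m x ≠ ∞ := fun x => ENNReal.ofReal_ne_top
    have hmnull : ∀ x, wordWeight μ (FreeMonoid.ofList x) = 0 → m x = 0 := fun x hx => by
      rw [hm, density, hx, mul_zero, ENNReal.ofReal_zero]
    have hm1 : m [] = 1 := by
      rw [hm, density, FreeMonoid.ofList_nil, h1, wordWeight_one, mul_one, ENNReal.ofReal_one]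
    have hum : ofDensity μ m = u := ofDensity_density h0 hnull
    -- A flow below m and its complement yield a harmonic decomposition of u; minimality makes m₁
    -- proportional to m, and the constant is read at the root.
    obtain ⟨g, hg⟩ := hflow.exists_eq_rayFlow hfin hm1 (by
      intro m₁ hm₁ hle x
      have hfin₁ : ∀ x, m₁ x ≠ ∞ := fun x => ne_top_of_le_ne_top (hfin x) (hle x)
      have hnull₁ : ∀ x, wordWeight μ (FreeMonoid.ofList x) = 0 → m₁ x = 0 := fun x hx =>
        nonpos_iff_eq_zero.1 ((hle x).trans_eq (hmnull x hx))
      obtain ⟨⟨c, hc⟩, -⟩ := hmin (ofDensity μ m₁)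
        (ofDensity_mem_positiveHarmonic hq ht hν hm₁ hfin₁ hnull₁)
        (ofDensity μ fun x => m x - m₁ x)
        (ofDensity_mem_positiveHarmonic hq ht hν (hflow.sub hm₁ hle hfin)
          (fun x => ne_top_of_le_ne_top (hfin x) tsub_le_self)
          (fun x hx => by rw [hmnull x hx, zero_tsub]))
        (by
          rw [← hum]
          funext x
          rw [Pi.add_apply, ofDensity, ofDensity, ofDensity, ← add_div,
            ENNReal.toReal_sub_of_le (hle _) (hfin _), add_sub_cancel])
      have hc1 : c = (m₁ []).toReal := by
        have := congrFun hc 1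
        rw [Pi.smul_apply, h1, ofDensity, wordWeight_one, div_one, smul_eq_mul, mul_one] at this
        exact this.symm
      by_cases hx : wordWeight μ (FreeMonoid.ofList x) = 0
      · rw [hmnull x hx, hnull₁ x hx, mul_zero]
      · have := congrFun hc (FreeMonoid.ofList x)
        rw [Pi.smul_apply, smul_eq_mul, ← hum, ofDensity, ofDensity, ← mul_div_assoc,
          div_left_inj' hx, hc1, ← ENNReal.toReal_mul, ENNReal.toReal_eq_toReal_iff' (hfin₁ _)
            (ENNReal.mul_ne_top (hfin₁ _) (hfin _))] at this
        exact this)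
    refine ⟨g, fun n => ?_, by rw [← hum, hg, ofDensity_rayFlow]⟩
    have h2 : m ((List.ofFn fun i : Fin n => g i) ++ [g n]) ≠ 0 := by
      rw [hg, rayFlow, if_pos]
      · exact one_ne_zero
      · rw [isInitialSegment_concat, isInitialSegment_iff]
        simp
    have h3 := mt (hmnull _) h2
    rw [FreeMonoid.ofList_append, wordWeight_mul, FreeMonoid.ofList_singleton, wordWeight_of] at h3
    exact pos_iff_ne_zero.2 fun h => right_ne_zero_of_mul h3 (by rw [h, ENNReal.toReal_zero])
  · rintro ⟨g, hg, rfl⟩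
    rw [← ofDensity_rayFlow]
    have hfin : ∀ x, rayFlow g x ≠ ∞ := fun x => by
      rw [rayFlow]
      split_ifs <;> simp
    have hpos : ∀ x, IsInitialSegment (FreeMonoid.ofList x) g →
        wordWeight μ (FreeMonoid.ofList x) ≠ 0 := by
      intro x hx
      induction x using List.reverseRecOn with
      | nil => rw [FreeMonoid.ofList_nil, wordWeight_one]; exact one_ne_zero
      | append_singleton x w ih =>
        obtain ⟨h1, rfl⟩ := isInitialSegment_concat.1 hx
        rw [FreeMonoid.ofList_append, wordWeight_mul, FreeMonoid.ofList_singleton, wordWeight_of]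
        exact mul_ne_zero (ih h1) (ENNReal.toReal_pos (hg _).ne' (PMF.apply_ne_top _ _)).ne'
    have hnull : ∀ x, wordWeight μ (FreeMonoid.ofList x) = 0 → rayFlow g x = 0 := fun x hx => by
      rw [rayFlow, if_neg fun h => hpos x h hx]
    -- A function dominated by the kernel vanishes off the ray, so its density is a flow with no
    -- branching.
    have hmul : ∀ f ∈ positiveHarmonic ν, (∀ x, f x ≤ ofDensity μ (rayFlow g) x) →
        ∃ c : ℝ, f = c • ofDensity μ (rayFlow g) := by
      rintro f ⟨h0, hh⟩ hle
      have hray0 : ∀ x, ¬ IsInitialSegment x g → f x = 0 := by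
        intro x hx
        refine le_antisymm ((hle x).trans_eq ?_) (h0 x)
        rw [ofDensity, rayFlow, FreeMonoid.ofList_toList, if_neg hx, ENNReal.toReal_zero, zero_div]
      have hfnull : ∀ x, wordWeight μ x = 0 → f x = 0 := fun x hx =>
        hray0 x fun h => hpos x.toList h hx
      have hflow := (isHarmonic_iff_isFlow hq ht hν h0 hfnull).1 hh
      have h2 := hflow.eq_mul_rayFlow (g := g) fun x hx => by
        rw [density, hray0 _ hx, zero_mul, ENNReal.ofReal_zero]
      refine ⟨(density μ f []).toReal, ?_⟩
      conv_lhs => rw [← ofDensity_density h0 hfnull]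
      funext x
      rw [Pi.smul_apply, ofDensity, ofDensity, h2, ENNReal.toReal_mul, smul_eq_mul, mul_div_assoc]
    refine ⟨ofDensity_mem_positiveHarmonic hq ht hν (isFlow_rayFlow g) hfin hnull, ?_, ?_⟩
    · rw [ofDensity, wordWeight_one, div_one, rayFlow, FreeMonoid.ofList_toList,
        if_pos (show IsInitialSegment 1 g from isInitialSegment_nil g), ENNReal.toReal_one]
    · intro f₁ h₁ f₂ h₂ h
      refine ⟨hmul f₁ h₁ fun x => ?_, hmul f₂ h₂ fun x => ?_⟩
      · rw [h, Pi.add_apply]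
        exact le_add_of_nonneg_right (h₂.1 x)
      · rw [h, Pi.add_apply]
        exact le_add_of_nonneg_left (h₁.1 x)

end Harmonic

/-! ### The jump weight of the mixed law -/

section Mixed

variable {W : Type*} {μ : PMF (FreeMonoid W)} {Ω : Type*} [MeasurableSpace Ω]
  {lam : Measure Ω} {τ : (ℕ → FreeMonoid W) × Ω → WithTop ℕ}

lemma exists_letter (hμ : μ.support ⊆ Set.range (FreeMonoid.of : W → FreeMonoid W)) :
    ∃ w : W, μ (FreeMonoid.of w) ≠ 0 := by
  obtain ⟨g, hg⟩ := μ.support_nonempty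
  obtain ⟨w, rfl⟩ := hμ hg
  exact ⟨w, hg⟩

lemma apply_eq_wordWeight (hμ : μ.support ⊆ Set.range (FreeMonoid.of : W → FreeMonoid W))
    (y : List W) : (μ (FreeMonoid.ofList y)).toReal =
      wordWeight μ (FreeMonoid.ofList y) * (if y.length = 1 then 1 else 0) := by
  split_ifs with h
  · obtain ⟨w, rfl⟩ := List.length_eq_one_iff.1 h
    rw [FreeMonoid.ofList_singleton, wordWeight_of, mul_one]
  · rw [mul_zero, ENNReal.toReal_eq_zero_iff]
    left
    by_contra hy
    obtain ⟨w, hw⟩ := hμ ((PMF.mem_support_iff _ _).2 hy)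
    rw [← FreeMonoid.ofList.injective hw] at h
    exact h rfl

lemma wordWeight_ne_zero_iff (y : List W) : wordWeight μ (FreeMonoid.ofList y) ≠ 0 ↔
    ∀ w ∈ y, μ (FreeMonoid.of w) ≠ 0 := by
  rw [wordWeight, FreeMonoid.toList_ofList, Ne, List.prod_eq_zero_iff]
  simp [ENNReal.toReal_eq_zero_iff, PMF.apply_ne_top]

open Classical in
/-- Replace every letter of zero weight by the letter `w₀`. -/
noncomputable def chargedLetter (μ : PMF (FreeMonoid W)) (w₀ w : W) : W :=
  if μ (FreeMonoid.of w) = 0 then w₀ else w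

/-- `IsStoppingWeight` concerns all words, but the almost sure bound says nothing about null ones.
Substituting w₀ transfers the bound to them, and `mixedLaw` is unaffected because null words have
law 0. -/
lemma wordWeight_map_chargedLetter_pos {w₀ : W} (hw₀ : μ (FreeMonoid.of w₀) ≠ 0) (y : List W) :
    0 < wordWeight μ (FreeMonoid.ofList (y.map (chargedLetter μ w₀))) := by
  refine (wordWeight_nonneg _).lt_of_ne' ((wordWeight_ne_zero_iff _).2 fun w hw => ?_)
  obtain ⟨w', -, rfl⟩ := List.mem_map.1 hw
  rw [chargedLetter]
  split_ifs with h
  exacts [hw₀, h]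

lemma map_chargedLetter {w₀ : W} {y : List W} (hy : wordWeight μ (FreeMonoid.ofList y) ≠ 0) :
    y.map (chargedLetter μ w₀) = y := by
  rw [wordWeight_ne_zero_iff] at hy
  conv_rhs => rw [← List.map_id y]
  exact List.map_congr_left fun w hw => if_neg (hy w hw)

/-- The ratio of `μ_{τ,t}(y)` to the weight of `y`, with letters of zero weight replaced by
`w₀`. -/
noncomputable def mixedWeight (μ : PMF (FreeMonoid W)) (lam : Measure Ω)
    (τ : (ℕ → FreeMonoid W) × Ω → WithTop ℕ) (w₀ : W) (t : ℝ≥0) (y : List W) : ℝ≥0 :=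
  t * (if y.length = 1 then 1 else 0) +
    (1 - t) * stopWeight lam τ (y.map (chargedLetter μ w₀))

variable [Countable W] [IsProbabilityMeasure lam]

lemma isStoppingWeight_mixedWeight
    (hμ : μ.support ⊆ Set.range (FreeMonoid.of : W → FreeMonoid W))
    (hτ : IsRandomizedStoppingTime τ) {M : ℕ} (hM0 : 0 < M)
    (hM : ∀ᵐ p ∂((pathMeasure μ).prod lam), τ p ≤ (M : WithTop ℕ)) {w₀ : W}
    (hw₀ : μ (FreeMonoid.of w₀) ≠ 0) {t : ℝ≥0} (ht : t ≤ 1) :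
    IsStoppingWeight M t (mixedWeight μ lam τ w₀ t) := by
  refine ⟨fun z hz => ?_, fun y hy => ?_, fun w => ?_⟩
  · have h1 : ∑ j ∈ Finset.range (M + 1), (if (z.take j).length = 1 then (1 : ℝ≥0) else 0) = 1 := by
      rw [Finset.sum_eq_single 1]
      · rw [if_pos (by rw [List.length_take]; omega)]
      · intro j hj hj1
        rw [Finset.mem_range] at hj
        rw [if_neg (by rw [List.length_take]; omega)]
      · intro h
        exact absurd (Finset.mem_range.2 (by omega)) h
    simp only [mixedWeight, Finset.sum_add_distrib, ← Finset.mul_sum, h1, List.map_take]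
    rw [sum_stopWeight hμ hτ hM (by rwa [List.length_map])
      (wordWeight_map_chargedLetter_pos hw₀ z), mul_one, mul_one, add_tsub_cancel_of_le ht]
  · rw [mixedWeight, if_neg (by omega), stopWeight_eq_zero hμ hτ hM (by rwa [List.length_map])
      (wordWeight_map_chargedLetter_pos hw₀ y), mul_zero, mul_zero, add_zero]
  · rw [mixedWeight, if_pos (List.length_singleton), mul_one]
    exact_mod_cast le_self_add

lemma mixedLaw_eq (hμ : μ.support ⊆ Set.range (FreeMonoid.of : W → FreeMonoid W))
    (hτ : IsRandomizedStoppingTime τ) (w₀ : W) {t : ℝ≥0} (ht : t ≤ 1) (y : List W) :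
    mixedLaw μ lam τ t (FreeMonoid.ofList y) =
      wordWeight μ (FreeMonoid.ofList y) * mixedWeight μ lam τ w₀ t y := by
  rw [mixedLaw, apply_eq_wordWeight hμ, stoppedLaw_eq hμ hτ]
  by_cases hy : wordWeight μ (FreeMonoid.ofList y) = 0
  · simp [hy]
  · rw [mixedWeight, map_chargedLetter hy]
    push_cast [NNReal.coe_sub ht]
    split_ifs <;> push_cast <;> ring

end Mixed

end FreeSemigroupWalk

theorem mainTheorem4 {W : Type*} [Countable W]
    (μ : PMF (FreeMonoid W))
    (hμ : μ.support ⊆ Set.range (FreeMonoid.of : W → FreeMonoid W))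
    {Ω : Type*} [MeasurableSpace Ω] (lam : MeasureTheory.Measure Ω)
    [MeasureTheory.IsProbabilityMeasure lam]
    (τ : (ℕ → FreeMonoid W) × Ω → WithTop ℕ)
    (hτ : FreeSemigroupWalk.IsRandomizedStoppingTime τ)
    (hbdd : ∃ M : ℕ, ∀ᵐ p ∂((FreeSemigroupWalk.pathMeasure μ).prod lam), τ p ≤ (M : WithTop ℕ))
    (t : ℝ) (ht0 : 0 < t) (ht1 : t ≤ 1)
    (u : FreeMonoid W → ℝ) :
    FreeSemigroupWalk.IsMinimalHarmonic (FreeSemigroupWalk.mixedLaw μ lam τ t) u ↔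
      ∃ g : ℕ → W, (∀ n, 0 < μ (FreeMonoid.of (g n))) ∧
        u = fun x => FreeSemigroupWalk.martinKernel μ x g := by
  obtain ⟨M, hM⟩ := hbdd
  obtain ⟨w₀, hw₀⟩ := FreeSemigroupWalk.exists_letter hμ
  have : Nonempty W := ⟨w₀⟩
  lift t to NNReal using ht0.le
  have ht1' : t ≤ 1 := by exact_mod_cast ht1
  -- The bound must be positive to leave room for the one-letter jumps of t μ, even when τ = 0.
  have hM' : ∀ᵐ p ∂((FreeSemigroupWalk.pathMeasure μ).prod lam),
      τ p ≤ ((M + 1 : ℕ) : WithTop ℕ) := by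
    filter_upwards [hM] with p hp
    exact hp.trans (by exact_mod_cast Nat.le_succ M)
  exact FreeSemigroupWalk.isMinimalHarmonic_iff
    (FreeSemigroupWalk.isStoppingWeight_mixedWeight hμ hτ (Nat.succ_pos M) hM' hw₀ ht1') ht0
    (FreeSemigroupWalk.mixedLaw_eq hμ hτ w₀ ht1') u
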